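/- **Definitions.** A closure space $(X,c)$ is a set $X$ with a map $c:\mathcal P(X)\to\mathcal P(X)$ such that $c(\emptyset)=\emptyset$, $A\subseteq c(A)$ and $c(A\cup B)=c(A)\cup c(B)$ for all $A,B\subseteq X$; its interior operation is $i(A)=X\setminus c(X\setminus A)$. A map $f:(X,c)\to(Y,d)$ is continuous if $f(c(A))\subseteq d(f(A))$ for all $A\subseteq X$. A subset $A\subseteq X$ carries the subspace closure $B\mapsto c(B)\cap A$. A family $\mathcal U$ of subsets of $X$ is an interior cover if $\bigcup_{U\in\mathcal U} i(U)=X$. The product closure on $\prod_\alpha X_\alpha$ is the one for which the sets $\bigcap_{\alpha\in F}\pi_\alpha^{-1}(V_\alpha)$, with $F$ finite and $x_\alpha\in i(V_\alpha)$, form a local base at $x$. Let $J\in\{I,J_+,J_1\}$, where $I=[0,1]$ has its usual topological closure, $J_+=\{0,1\}$ with $c(\{0\})=\{0,1\}$, $c(\{1\})=\{1\}$, and $J_1=\{0,1\}$ with the indiscrete closure ($c(A)=J_1$ for $A\ne\emptyset$). Let $|\Delta^n|^J$ be, respectively, the standard topological $n$-simplex in $\mathbb R^{n+1}$, the set $\{0,\dots,n\}$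 with $c(A)=\{j\mid \exists\, i\in A,\ i\le j\}$, and the set $\{0,\dots,n\}$ with the indiscrete closure. Let $J^{\times n}$ be the $n$-fold product of $J$ with the product closure (a point if $n=0$). *Singular simplicial homology.* $C_n^{(J,\times)}(X)$ is the free abelian group on the continuous maps $\sigma:|\Delta^n|^J\to X$, with $\partial\sigma=\sum_{i=0}^n(-1)^i\,\sigma\circ d^i$, where $d^i:|\Delta^{n-1}|^J\to|\Delta^n|^J$ is induced by the order-preserving injection $\{0,\dots,n-1\}\to\{0,\dots,n\}$ that misses $i$. *Singular cubical homology.* $\square C_n^{(J,\times)}(X)$ is the free abelian group on the continuous maps $\sigma:J^{\times n}\to X$ modulo the subgroup generated by the degenerate ones, that is, those with $n\ge1$ that factor as $J^{\times n}\to J^{\times(n-1)}\to X$, a projection forgetting one coordinate followed by a continuous map; $\partial\sigma=\sum_{i=1}^n(-1)^i(A_i\sigma-B_i\sigma)$, where $A_i\sigma$ and $B_i\sigma$ are the restrictions of $\sigma$ to the faces on which the $i$-th coordinate is $0$ and $1$. For $A\subseteq X$ the relative groups $H_n^{(J,\times)}(X,A)$ and $\square H_n^{(J,\times)}(X,A)$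 are the homology groups of the quotient complexes $C_\bullet^{(J,\times)}(X)/C_\bullet^{(J,\times)}(A)$ and $\square C_\bullet^{(J,\times)}(X)/\square C_\bullet^{(J,\times)}(A)$. **Theorem (Excision).** Let $J\in\{I,J_+,J_1\}$ and let $(X,c)$ be a closure space with interior operation $i$. Let $Z\subseteq A\subseteq X$ be such that $c(Z)\subseteq i(A)$. Then the inclusion $(X\setminus Z,\,A\setminus Z)\to(X,A)$ induces isomorphisms $$H_n^{(J,\times)}(X\setminus Z,\,A\setminus Z)\cong H_n^{(J,\times)}(X,A)\quad\text{and}\quad \square H_n^{(J,\times)}(X\setminus Z,\,A\setminus Z)\cong\square H_n^{(J,\times)}(X,A)$$ for all $n\ge0$. Equivalently, for every interior cover $\{A,B\}$ of $(X,c)$, the inclusion $(B,A\cap B)\to(X,A)$ induces isomorphisms $$H_n^{(J,\times)}(B,A\cap B)\cong H_n^{(J,\times)}(X,A)\quad\text{and}\quad \square H_n^{(J,\times)}(B,A\cap B)\cong\square H_n^{(J,\times)}(X,A)$$ for all $n\ge0$. -/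

import Mathlib

open CategoryTheory CategoryTheory.Limits Opposite

universe u v

noncomputable section

namespace Pretop

/-! ### Čech closure spaces -/

/-- A (Čech) closure operation on a set. -/
@[ext]
structure Closure (X : Type u) where
  cl : Set X → Set X
  cl_empty : cl ∅ = ∅
  subset_cl : ∀ A, A ⊆ cl A
  cl_union : ∀ A B, cl (A ∪ B) = cl A ∪ cl B

/-- A (Čech) closure space: a set together with a closure operation on it. -/
structure Cl where
  carrier : Type u
  str : Closure carrier

namespace Cl

instance : CoeSort Cl.{u} (Type u) := ⟨Cl.carrier⟩

/-- The closure `c(A)` of a subset. -/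
def cl (X : Cl.{u}) (A : Set X) : Set X := X.str.cl A

/-- The interior `i(A) = X ∖ c(X ∖ A)` of a subset. -/
def int (X : Cl.{u}) (A : Set X) : Set X := (X.cl Aᶜ)ᶜ

theorem cl_mono (X : Cl.{u}) {A B : Set X} (h : A ⊆ B) : X.cl A ⊆ X.cl B := by
  have e := X.str.cl_union A B
  rw [Set.union_eq_self_of_subset_left h] at e
  exact fun x hx => by
    change x ∈ X.str.cl B
    rw [e]
    exact Or.inl hx

theorem int_inter (X : Cl.{u}) (A B : Set X) : X.int (A ∩ B) = X.int A ∩ X.int B := by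
  have e := X.str.cl_union Aᶜ Bᶜ
  simp only [int, cl, Set.compl_inter, e, Set.compl_union]

/-- A family `𝒰` of subsets is an interior cover if the interiors of its members cover `X`. -/
def IsInteriorCover (X : Cl.{u}) (𝒰 : Set (Set X)) : Prop :=
  (⋃ U ∈ 𝒰, X.int U) = Set.univ

/-- Continuous maps of closure spaces: `f(c(A)) ⊆ d(f(A))` for all `A`. -/
@[ext]
structure Map (X : Cl.{u}) (Y : Cl.{v}) where
  toFun : X → Y
  cont : ∀ A : Set X, toFun '' X.cl A ⊆ Y.cl (toFun '' A)

namespace Map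

instance {X : Cl.{u}} {Y : Cl.{v}} : CoeFun (Map X Y) (fun _ => X → Y) := ⟨Map.toFun⟩

def id (X : Cl.{u}) : Map X X := ⟨fun x => x, fun A => by simp⟩

def comp {X : Cl} {Y : Cl} {Z : Cl} (g : Map Y Z) (f : Map X Y) : Map X Z where
  toFun := fun x => g (f x)
  cont := fun A => by
    have h1 := Set.image_mono (f := g.toFun) (f.cont A)
    have h2 := g.cont (f.toFun '' A)
    rw [Set.image_image] at h1 h2
    exact h1.trans h2

end Map

/-- The category of closure spaces and continuous maps. -/
instance : Category Cl.{u} where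
  Hom X Y := Map X Y
  id X := Map.id X
  comp f g := Map.comp g f

/-- The subspace `A` of a closure space `X`: the closure of `B ⊆ A` in `A` is `c(B) ∩ A`. -/
abbrev sub (X : Cl.{u}) (A : Set X) : Cl.{u} where
  carrier := A
  str :=
    { cl := fun B => Subtype.val ⁻¹' X.cl (Subtype.val '' B)
      cl_empty := by
        have h : X.cl ∅ = ∅ := X.str.cl_empty
        simp [h]
      subset_cl := fun B b hb => X.str.subset_cl _ ⟨b, hb, rfl⟩
      cl_union := fun B C => by
        have h := X.str.cl_union (Subtype.val '' B) (Subtype.val '' C)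
        simp only [cl, Set.image_union, h, Set.preimage_union] }

/-- The inclusion of a subspace. -/
def incl (X : Cl.{u}) (A : Set X) : X.sub A ⟶ X where
  toFun := Subtype.val
  cont := by
    rintro B _ ⟨b, hb, rfl⟩
    exact hb

/-- A continuous map `f : Y → X` with `f(S) ⊆ A` restricts to a continuous map `S → A`. -/
def restrict {Y X : Cl.{u}} (f : Y ⟶ X) {S : Set Y} {A : Set X}
    (h : Set.MapsTo f.toFun S A) : Y.sub S ⟶ X.sub A where
  toFun := Set.MapsTo.restrict f.toFun S A h
  cont := by
    rintro B _ ⟨b, hb, rfl⟩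
    have h1 := f.cont _ ⟨b.1, hb, rfl⟩
    have e : f.toFun '' (Subtype.val '' B) =
        Subtype.val '' (Set.MapsTo.restrict f.toFun S A h '' B) := by
      rw [Set.image_image, Set.image_image]
      rfl
    rw [e] at h1
    exact h1

/-- A topological space, viewed as a closure space. -/
abbrev ofTop (X : Type u) [TopologicalSpace X] : Cl.{u} where
  carrier := X
  str :=
    { cl := closure
      cl_empty := closure_empty
      subset_cl := fun _ => subset_closure
      cl_union := fun _ _ => closure_union }

/-- The (finite) product closure: the sets `∏ V i`, with `V i` a neighbourhood of `x i`, form a local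
base at `x`. -/
abbrev pi {ι : Type v} (X : ι → Cl.{u}) : Cl.{max u v} where
  carrier := ∀ i, X i
  str :=
    { cl := fun A => {x | ∀ V : ∀ i, Set (X i), {i | V i ≠ Set.univ}.Finite →
        (∀ i, x i ∈ (X i).int (V i)) → ∃ a ∈ A, ∀ i, a i ∈ V i}
      cl_empty := by
        ext x
        simp only [Set.mem_ofPred_eq, Set.mem_empty_iff_false, iff_false, not_forall]
        refine ⟨fun _ => Set.univ, by simp, fun i => ?_, by simp⟩
        have h : (X i).cl ∅ = ∅ := (X i).str.cl_empty
        simp [int, h]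
      subset_cl := fun A x hx V _ hV => ⟨x, hx, fun i => by
        by_contra h
        exact hV i ((X i).str.subset_cl _ h)⟩
      cl_union := fun A B => by
        ext x
        constructor
        · intro h
          by_contra hc
          simp only [Set.mem_union, Set.mem_ofPred_eq, not_or, not_forall] at hc
          obtain ⟨⟨V, fV, hV, nV⟩, ⟨W, fW, hW, nW⟩⟩ := hc
          obtain ⟨a, ha, haVW⟩ := h (fun i => V i ∩ W i)
            ((fV.union fW).subset (fun i hi => by
              by_contra hn
              simp only [Set.mem_union, Set.mem_ofPred_eq, not_or, not_not] at hn
              exact hi (by rw [hn.1, hn.2, Set.inter_self])))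
            (fun i => by rw [int_inter]; exact ⟨hV i, hW i⟩)
          rcases ha with ha | ha
          · exact nV ⟨a, ha, fun i => (haVW i).1⟩
          · exact nW ⟨a, ha, fun i => (haVW i).2⟩
        · rintro (h | h) V fV hV
          · obtain ⟨a, ha, haV⟩ := h V fV hV
            exact ⟨a, Or.inl ha, haV⟩
          · obtain ⟨a, ha, haV⟩ := h V fV hV
            exact ⟨a, Or.inr ha, haV⟩ }

/-- The closure space `J_{m,≤}`: the set `{0, …, m}` with `c(i) = {j | i ≤ j}`. -/
abbrev upper (m : ℕ) : Cl.{0} where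
  carrier := Fin (m + 1)
  str :=
    { cl := fun A => {j | ∃ i ∈ A, i ≤ j}
      cl_empty := by simp
      subset_cl := fun A j hj => ⟨j, hj, le_rfl⟩
      cl_union := fun A B => by
        ext j
        simp only [Set.mem_union, Set.mem_ofPred_eq]
        constructor
        · rintro ⟨i, hi | hi, h⟩
          · exact Or.inl ⟨i, hi, h⟩
          · exact Or.inr ⟨i, hi, h⟩
        · rintro (⟨i, hi, h⟩ | ⟨i, hi, h⟩)
          · exact ⟨i, Or.inl hi, h⟩
          · exact ⟨i, Or.inr hi, h⟩ }

/-- The closure space `J_{m,⊤}`: the set `{0, …, m}` with the indiscrete closure. -/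
abbrev indiscrete (m : ℕ) : Cl.{0} where
  carrier := Fin (m + 1)
  str :=
    { cl := fun A => {_j | A.Nonempty}
      cl_empty := by simp
      subset_cl := fun A j hj => ⟨j, hj⟩
      cl_union := fun A B => by
        ext j
        simp only [Set.union_nonempty, Set.mem_union, Set.mem_ofPred_eq] }

end Cl

/-! ### The interval objects and the associated simplices -/

/-- The three interval objects `I`, `J₊`, `J₁`. -/
inductive IntervalObj
  /-- the unit interval `[0,1]` with its usual topology -/
  | unit
  /-- `J₊ = {0,1}` with `c(0) = {0,1}` and `c(1) = {1}` -/
  | plus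
  /-- `J₁ = {0,1}` with the indiscrete closure -/
  | one

namespace IntervalObj

/-- The underlying closure space of an interval object. -/
def space : IntervalObj → Cl.{0}
  | unit => Cl.ofTop unitInterval
  | plus => Cl.upper 1
  | one => Cl.indiscrete 1

/-- The endpoint `ε ∈ {0,1}` of an interval object (`false` is `0`, `true` is `1`). -/
def endpoint : (J : IntervalObj) → Bool → J.space
  | unit, ε => (bif ε then (1 : unitInterval) else (0 : unitInterval))
  | plus, ε => (bif ε then (1 : Fin 2) else (0 : Fin 2))
  | one, ε => (bif ε then (1 : Fin 2) else (0 : Fin 2))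

/-- The simplices `|Δⁿ|^J`, functorially in `[n]`: the standard topological simplex for `J = I`,
the space `J_{n,≤}` for `J = J₊` and the space `J_{n,⊤}` for `J = J₁`. -/
def simplex : IntervalObj → (SimplexCategory ⥤ Cl.{0})
  | unit =>
    { obj := fun n => Cl.ofTop (stdSimplex ℝ (Fin (n.len + 1)))
      map := fun f =>
        { toFun := stdSimplex.map f.toOrderHom
          cont := fun _ => image_closure_subset_closure_image (stdSimplex.continuous_map
            (S := ℝ) f.toOrderHom) }
      map_id := fun n => by
        apply Cl.Map.ext
        funext x
        exact stdSimplex.map_id_apply x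
      map_comp := fun f g => by
        apply Cl.Map.ext
        funext x
        exact (stdSimplex.map_comp_apply f.toOrderHom g.toOrderHom x).symm }
  | plus =>
    { obj := fun n => Cl.upper n.len
      map := fun f =>
        { toFun := f.toOrderHom
          cont := by
            rintro A _ ⟨j, ⟨i, hi, hij⟩, rfl⟩
            exact ⟨_, ⟨i, hi, rfl⟩, f.toOrderHom.monotone hij⟩ }
      map_id := fun n => rfl
      map_comp := fun f g => rfl }
  | one =>
    { obj := fun n => Cl.indiscrete n.len
      map := fun f =>
        { toFun := f.toOrderHom
          cont := by
            rintro A _ ⟨j, hA, rfl⟩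
            exact Set.Nonempty.image _ hA }
      map_id := fun n => rfl
      map_comp := fun f g => rfl }

/-! ### Singular simplicial chains -/

/-- The `J` nerve of a closure space: its `n`-simplices are the continuous maps `|Δⁿ|^J → X`. -/
def nerve (J : IntervalObj) : Cl.{u} ⥤ SSet.{u} where
  obj X :=
    { obj := fun n => Cl.Map (J.simplex.obj n.unop) X
      map := fun f => ↾(fun σ : Cl.Map _ X => σ.comp (J.simplex.map f.unop))
      map_id := fun n => by
        ext σ
        simp only [unop_id, CategoryTheory.Functor.map_id]
        rfl
      map_comp := fun f g => by
        ext σ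
        simp only [unop_comp, CategoryTheory.Functor.map_comp]
        rfl }
  map f := { app := fun n => ↾(fun σ : Cl.Map _ _ => Cl.Map.comp f σ) }

/-- The free abelian group functor; abelian groups are regarded as `ℤ`-modules. -/
def freeAb : Type u ⥤ ModuleCat.{u} ℤ where
  obj S := ModuleCat.of ℤ (S →₀ ℤ)
  map f := ModuleCat.ofHom (Finsupp.lmapDomain ℤ ℤ f)
  map_id S := by
    ext : 1
    exact Finsupp.lmapDomain_id ℤ ℤ
  map_comp f g := by
    ext : 1
    exact Finsupp.lmapDomain_comp ℤ ℤ f g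

/-- The complex of `(J,×)` singular simplicial chains: in degree `n` it is the free abelian group
on the continuous maps `σ : |Δⁿ|^J → X`, and `∂ σ = ∑ (-1)ⁱ σ ∘ dⁱ`. -/
def simplicialChains (J : IntervalObj) : Cl.{u} ⥤ ChainComplex (ModuleCat.{u} ℤ) ℕ :=
  J.nerve ⋙ (SimplicialObject.whiskering (Type u) (ModuleCat.{u} ℤ)).obj freeAb ⋙
    AlgebraicTopology.alternatingFaceMapComplex (ModuleCat.{u} ℤ)

/-! ### Singular cubical chains -/

/-- The cube `J^{×n}`. -/
abbrev cube (J : IntervalObj) (n : ℕ) : Cl.{0} := Cl.pi (fun _ : Fin n => J.space)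

/-- The face inclusion `J^{×n} → J^{×(n+1)}` which inserts the endpoint `ε` as `i`-th coordinate. -/
def coface (J : IntervalObj) {n : ℕ} (i : Fin (n + 1)) (ε : Bool) :
    Cl.Map (J.cube n) (J.cube (n + 1)) where
  toFun := fun a => i.insertNth (α := fun _ => J.space) (J.endpoint ε) a
  cont := by
    rintro A _ ⟨x, hx, rfl⟩ V _ hV
    obtain ⟨a, ha, haV⟩ := hx (fun k => V (i.succAbove k)) (Set.toFinite _)
      (fun k => by
        have h := hV (i.succAbove k)
        beta_reduce at h
        rwa [Fin.insertNth_apply_succAbove] at h)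
    refine ⟨_, ⟨a, ha, rfl⟩, fun k => ?_⟩
    rcases Fin.eq_self_or_eq_succAbove i k with rfl | ⟨j, rfl⟩
    · have h := hV k
      beta_reduce at h ⊢
      rw [Fin.insertNth_apply_same] at h ⊢
      by_contra hn
      exact h (J.space.str.subset_cl _ hn)
    · beta_reduce
      rw [Fin.insertNth_apply_succAbove]
      exact haV j

/-- The projection `J^{×(n+1)} → J^{×n}` which forgets the `i`-th coordinate. -/
def codegeneracy (J : IntervalObj) {n : ℕ} (i : Fin (n + 1)) :
    Cl.Map (J.cube (n + 1)) (J.cube n) where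
  toFun := fun a => i.removeNth (α := fun _ => J.space) a
  cont := by
    rintro A _ ⟨x, hx, rfl⟩ V _ hV
    obtain ⟨a, ha, haV⟩ := hx (i.insertNth (α := fun _ => Set J.space) Set.univ V) (Set.toFinite _)
      (fun k => by
        rcases Fin.eq_self_or_eq_succAbove i k with rfl | ⟨j, rfl⟩
        · have h : J.space.cl ∅ = ∅ := J.space.str.cl_empty
          rw [Fin.insertNth_apply_same]
          simp [Cl.int, h]
        · rw [Fin.insertNth_apply_succAbove]
          exact hV j)
    refine ⟨_, ⟨a, ha, rfl⟩, fun k => ?_⟩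
    have h := haV (i.succAbove k)
    rwa [Fin.insertNth_apply_succAbove] at h

/-- The singular `n`-cubes of `X`: the continuous maps `J^{×n} → X`. -/
abbrev Cube (J : IntervalObj) (n : ℕ) (X : Cl.{u}) : Type u := Cl.Map (J.cube n) X

/-- A singular cube is degenerate if it is the composite of a coordinate projection
`J^{×(n+1)} → J^{×n}` and a singular `n`-cube. -/
def IsDegenerate (J : IntervalObj) {X : Cl.{u}} : {n : ℕ} → J.Cube n X → Prop
  | 0, _ => False
  | n + 1, σ => ∃ (i : Fin (n + 1)) (τ : J.Cube n X), σ = τ.comp (J.codegeneracy i)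

/-- The free abelian group on the singular `n`-cubes. -/
abbrev cubicalFree (J : IntervalObj) (n : ℕ) (X : Cl.{u}) : Type u := J.Cube n X →₀ ℤ

/-- The subgroup generated by the degenerate singular `n`-cubes. -/
def degenerateChains (J : IntervalObj) (n : ℕ) (X : Cl.{u}) : Submodule ℤ (J.cubicalFree n X) :=
  Submodule.span ℤ {c | ∃ σ : J.Cube n X, J.IsDegenerate σ ∧ c = Finsupp.single σ 1}

/-- The face operator induced by `coface i ε` on chains; `ε = false` gives `Aᵢ` and `ε = true`
gives `Bᵢ`. -/
def faceChain (J : IntervalObj) {n : ℕ} (X : Cl.{u}) (i : Fin (n + 1)) (ε : Bool) :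
    J.cubicalFree (n + 1) X →ₗ[ℤ] J.cubicalFree n X :=
  Finsupp.lmapDomain ℤ ℤ (fun σ : J.Cube (n + 1) X => σ.comp (J.coface i ε))

/-- The boundary `∂ σ = ∑_{i=1}^{n+1} (-1)ⁱ (Aᵢ σ - Bᵢ σ)` of an `(n+1)`-cube; the coordinates are
numbered from `0` here, whence the exponent. -/
def cubicalBoundary (J : IntervalObj) (n : ℕ) (X : Cl.{u}) :
    J.cubicalFree (n + 1) X →ₗ[ℤ] J.cubicalFree n X :=
  ∑ i : Fin (n + 1), (-1 : ℤ) ^ ((i : ℕ) + 1) • (J.faceChain X i false - J.faceChain X i true)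

theorem coface_comp_coface (J : IntervalObj) {n : ℕ} (i : Fin (n + 2)) (j : Fin (n + 1))
    (ε δ : Bool) :
    (J.coface i ε).comp (J.coface j δ) =
      (J.coface (i.succAbove j) δ).comp (J.coface (j.predAbove i) ε) := by
  apply Cl.Map.ext
  funext a l
  change i.insertNth (α := fun _ => J.space) _ (j.insertNth (α := fun _ => J.space) _ a) l =
    (i.succAbove j).insertNth (α := fun _ => J.space) _
      ((j.predAbove i).insertNth (α := fun _ => J.space) _ a) l
  rcases Fin.eq_self_or_eq_succAbove i l with rfl | ⟨m, rfl⟩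
  · have h := Fin.succAbove_succAbove_predAbove l j
    rw [Fin.insertNth_apply_same]
    refine Eq.trans ?_ (congrArg ((l.succAbove j).insertNth (α := fun _ => J.space) _
      ((j.predAbove l).insertNth (α := fun _ => J.space) _ a)) h)
    rw [Fin.insertNth_apply_succAbove, Fin.insertNth_apply_same]
  · rw [Fin.insertNth_apply_succAbove]
    rcases Fin.eq_self_or_eq_succAbove j m with rfl | ⟨p, rfl⟩
    · rw [Fin.insertNth_apply_same, Fin.insertNth_apply_same]
    · rw [Fin.insertNth_apply_succAbove, ← Fin.succAbove_succAbove_succAbove_predAbove,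
        Fin.insertNth_apply_succAbove, Fin.insertNth_apply_succAbove]

theorem codegeneracy_comp_coface_self (J : IntervalObj) {n : ℕ} (i : Fin (n + 1)) (ε : Bool) :
    (J.codegeneracy i).comp (J.coface i ε) = Cl.Map.id _ := by
  apply Cl.Map.ext
  funext a l
  change i.insertNth (α := fun _ => J.space) _ a (i.succAbove l) = a l
  rw [Fin.insertNth_apply_succAbove]

theorem codegeneracy_comp_coface (J : IntervalObj) {n : ℕ} (i : Fin (n + 2)) (j : Fin (n + 1))
    (ε : Bool) :
    (J.codegeneracy (i.succAbove j)).comp (J.coface i ε) =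
      (J.coface (j.predAbove i) ε).comp (J.codegeneracy j) := by
  apply Cl.Map.ext
  funext a l
  change i.insertNth (α := fun _ => J.space) _ a ((i.succAbove j).succAbove l) =
    (j.predAbove i).insertNth (α := fun _ => J.space) _ (fun m => a (j.succAbove m)) l
  rcases Fin.eq_self_or_eq_succAbove (j.predAbove i) l with rfl | ⟨m, rfl⟩
  · rw [Fin.succAbove_succAbove_predAbove, Fin.insertNth_apply_same, Fin.insertNth_apply_same]
  · rw [Fin.succAbove_succAbove_succAbove_predAbove, Fin.insertNth_apply_succAbove,
      Fin.insertNth_apply_succAbove]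

theorem faceChain_single (J : IntervalObj) {n : ℕ} (X : Cl.{u}) (i : Fin (n + 1)) (ε : Bool)
    (σ : J.Cube (n + 1) X) (r : ℤ) :
    J.faceChain X i ε (Finsupp.single σ r) = Finsupp.single (σ.comp (J.coface i ε)) r :=
  Finsupp.mapDomain_single

theorem faceChain_comp_faceChain (J : IntervalObj) {n : ℕ} (X : Cl.{u}) (i : Fin (n + 2))
    (j : Fin (n + 1)) (ε δ : Bool) :
    J.faceChain X j δ ∘ₗ J.faceChain X i ε =
      J.faceChain X (j.predAbove i) ε ∘ₗ J.faceChain X (i.succAbove j) δ := by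
  apply Finsupp.lhom_ext
  intro σ r
  simp only [LinearMap.comp_apply, faceChain_single]
  exact congrArg (fun f => Finsupp.single (σ.comp f) r) (J.coface_comp_coface i j ε δ)

theorem cubicalBoundary_comp (J : IntervalObj) (n : ℕ) (X : Cl.{u}) :
    J.cubicalBoundary n X ∘ₗ J.cubicalBoundary (n + 1) X = 0 := by
  have e : J.cubicalBoundary n X ∘ₗ J.cubicalBoundary (n + 1) X =
      ∑ p : Fin (n + 2) × Fin (n + 1), ((-1 : ℤ) ^ ((p.1 : ℕ) + 1) * (-1) ^ ((p.2 : ℕ) + 1)) •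
        ((J.faceChain X p.2 false - J.faceChain X p.2 true) ∘ₗ
          (J.faceChain X p.1 false - J.faceChain X p.1 true)) := by
    rw [← Finset.univ_product_univ, Finset.sum_product]
    refine LinearMap.ext fun c => ?_
    simp only [cubicalBoundary, LinearMap.comp_apply, LinearMap.sum_apply, LinearMap.smul_apply,
      map_sum, map_smul, Finset.smul_sum, smul_smul]
  rw [e]
  refine Finset.sum_involution (fun (p : Fin (n + 2) × Fin (n + 1)) _ =>
    (p.1.succAbove p.2, p.2.predAbove p.1)) ?_ ?_ ?_ ?_
  · rintro ⟨i, j⟩ -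
    dsimp only
    have hs : (-1 : ℤ) ^ (((i.succAbove j : Fin (n + 2)) : ℕ) + 1) *
        (-1) ^ (((j.predAbove i : Fin (n + 1)) : ℕ) + 1) =
        -((-1 : ℤ) ^ ((i : ℕ) + 1) * (-1) ^ ((j : ℕ) + 1)) := by
      rcases Fin.lt_or_le j.castSucc i with h | h
      · rw [Fin.succAbove_of_castSucc_lt _ _ h, Fin.predAbove_of_castSucc_lt _ _ h]
        have h0 : (i : ℕ) ≠ 0 := by
          have := Fin.lt_def.mp h
          omega
        obtain ⟨k, hk⟩ := Nat.exists_eq_succ_of_ne_zero h0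
        simp only [Fin.val_castSucc, Fin.val_pred, hk, Nat.succ_eq_add_one, Nat.add_sub_cancel]
        ring
      · rw [Fin.succAbove_of_le_castSucc _ _ h, Fin.predAbove_of_le_castSucc _ _ h]
        simp only [Fin.val_succ, Fin.coe_castPred]
        ring
    have hg : (J.faceChain X (j.predAbove i) false - J.faceChain X (j.predAbove i) true) ∘ₗ
        (J.faceChain X (i.succAbove j) false - J.faceChain X (i.succAbove j) true) =
        (J.faceChain X j false - J.faceChain X j true) ∘ₗ
        (J.faceChain X i false - J.faceChain X i true) := by
      simp only [LinearMap.comp_sub, LinearMap.sub_comp, J.faceChain_comp_faceChain X i j]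
      abel
    rw [hg, hs, neg_smul, add_neg_cancel]
  · rintro ⟨i, j⟩ - _ h
    exact Fin.succAbove_ne i j (congrArg Prod.fst h)
  · intro _ _
    exact Finset.mem_univ _
  · rintro ⟨i, j⟩ -
    dsimp only
    have h1 := Fin.succAbove_succAbove_predAbove i j
    refine Prod.ext h1 ?_
    change (j.predAbove i).predAbove (i.succAbove j) = j
    have h2 := Fin.succAbove_succAbove_predAbove (i.succAbove j) (j.predAbove i)
    rw [h1] at h2
    exact Fin.succAbove_right_injective h2

theorem cubicalBoundary_degenerate (J : IntervalObj) (n : ℕ) (X : Cl.{u}) :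
    J.degenerateChains (n + 1) X ≤
      (J.degenerateChains n X).comap (J.cubicalBoundary n X) := by
  refine Submodule.span_le.mpr ?_
  rintro _ ⟨σ, ⟨k, τ, rfl⟩, rfl⟩
  change J.cubicalBoundary n X _ ∈ J.degenerateChains n X
  simp only [cubicalBoundary, LinearMap.sum_apply, LinearMap.smul_apply, LinearMap.sub_apply,
    faceChain_single]
  refine Submodule.sum_mem _ fun i _ => Submodule.smul_mem _ _ ?_
  rcases Fin.eq_self_or_eq_succAbove i k with rfl | ⟨j, rfl⟩
  · have h : ∀ ε, (τ.comp (J.codegeneracy k)).comp (J.coface k ε) = τ := fun ε =>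
      congrArg τ.comp (J.codegeneracy_comp_coface_self k ε)
    rw [h, h, sub_self]
    exact Submodule.zero_mem _
  · cases n with
    | zero => exact j.elim0
    | succ n =>
      have h : ∀ ε, (τ.comp (J.codegeneracy (i.succAbove j))).comp (J.coface i ε) =
          (τ.comp (J.coface (j.predAbove i) ε)).comp (J.codegeneracy j) := fun ε =>
        congrArg τ.comp (J.codegeneracy_comp_coface i j ε)
      rw [h, h]
      exact Submodule.sub_mem _ (Submodule.subset_span ⟨_, ⟨j, _, rfl⟩, rfl⟩)
        (Submodule.subset_span ⟨_, ⟨j, _, rfl⟩, rfl⟩)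

/-- The map induced on free groups of cubes by a continuous map. -/
def cubicalFreeMap (J : IntervalObj) (n : ℕ) {X Y : Cl.{u}} (f : X ⟶ Y) :
    J.cubicalFree n X →ₗ[ℤ] J.cubicalFree n Y :=
  Finsupp.lmapDomain ℤ ℤ (fun σ : J.Cube n X => Cl.Map.comp f σ)

theorem cubicalFreeMap_single (J : IntervalObj) (n : ℕ) {X Y : Cl.{u}} (f : X ⟶ Y)
    (σ : J.Cube n X) (r : ℤ) :
    J.cubicalFreeMap n f (Finsupp.single σ r) = Finsupp.single (Cl.Map.comp f σ) r :=
  Finsupp.mapDomain_single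

theorem cubicalFreeMap_degenerate (J : IntervalObj) (n : ℕ) {X Y : Cl.{u}} (f : X ⟶ Y) :
    J.degenerateChains n X ≤ (J.degenerateChains n Y).comap (J.cubicalFreeMap n f) := by
  refine Submodule.span_le.mpr ?_
  rintro _ ⟨σ, hσ, rfl⟩
  change J.cubicalFreeMap n f _ ∈ J.degenerateChains n Y
  rw [cubicalFreeMap_single]
  refine Submodule.subset_span ⟨_, ?_, rfl⟩
  cases n with
  | zero => exact hσ
  | succ n =>
    obtain ⟨k, τ, rfl⟩ := hσ
    exact ⟨k, Cl.Map.comp f τ, rfl⟩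

theorem cubicalFreeMap_comm (J : IntervalObj) (n : ℕ) {X Y : Cl.{u}} (f : X ⟶ Y) :
    J.cubicalBoundary n Y ∘ₗ J.cubicalFreeMap (n + 1) f =
      J.cubicalFreeMap n f ∘ₗ J.cubicalBoundary n X := by
  apply Finsupp.lhom_ext
  intro σ r
  simp only [cubicalBoundary, LinearMap.comp_apply, cubicalFreeMap_single, LinearMap.sum_apply,
    LinearMap.smul_apply, LinearMap.sub_apply, faceChain_single, map_sum, map_smul, map_sub]
  rfl

theorem cubicalFreeMap_comp (J : IntervalObj) (n : ℕ) {X Y Z : Cl.{u}} (f : X ⟶ Y) (g : Y ⟶ Z) :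
    J.cubicalFreeMap n (f ≫ g) = J.cubicalFreeMap n g ∘ₗ J.cubicalFreeMap n f := by
  apply Finsupp.lhom_ext
  intro σ r
  simp only [LinearMap.comp_apply, cubicalFreeMap_single]
  rfl

/-- The complex of `(J,×)` singular cubical chains of a closure space: the free groups on singular
cubes modulo the subgroups generated by the degenerate cubes. -/
def cubicalComplex (J : IntervalObj) (X : Cl.{u}) : ChainComplex (ModuleCat.{u} ℤ) ℕ :=
  ChainComplex.of (fun n => ModuleCat.of ℤ (J.cubicalFree n X ⧸ J.degenerateChains n X))
    (fun n => ModuleCat.ofHom (Submodule.mapQ _ _ (J.cubicalBoundary n X)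
      (J.cubicalBoundary_degenerate n X)))
    (fun n => by
      ext : 1
      apply Submodule.linearMap_qext
      refine LinearMap.ext fun c => ?_
      exact congrArg (Submodule.mkQ _) (LinearMap.congr_fun (J.cubicalBoundary_comp n X) c))

/-- The functor of `(J,×)` singular cubical chains. -/
def cubicalChains (J : IntervalObj) : Cl.{u} ⥤ ChainComplex (ModuleCat.{u} ℤ) ℕ where
  obj X := J.cubicalComplex X
  map {X Y} f := ChainComplex.ofHom
    (fun n => ModuleCat.ofHom (Submodule.mapQ _ _ (J.cubicalFreeMap n f)
      (J.cubicalFreeMap_degenerate n f)))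
    (fun n => by
      simp only [cubicalComplex, ChainComplex.of_d]
      ext : 1
      apply Submodule.linearMap_qext
      refine LinearMap.ext fun c => ?_
      exact congrArg (Submodule.mkQ _) (LinearMap.congr_fun (J.cubicalFreeMap_comm n f) c))
  map_id X := by
    ext n : 2
    apply Submodule.linearMap_qext
    refine LinearMap.ext fun c => ?_
    exact congrArg (Submodule.mkQ _) (LinearMap.congr_fun (Finsupp.lmapDomain_id ℤ ℤ) c)
  map_comp f g := by
    ext n : 2
    apply Submodule.linearMap_qext
    refine LinearMap.ext fun c => ?_
    exact congrArg (Submodule.mkQ _) (LinearMap.congr_fun (J.cubicalFreeMap_comp n f g) c)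

end IntervalObj

/-! ### Relative homology -/

/-- For a functor `F` of chains, the relative chain complex `F(X,A) = F(X)/F(A)`. -/
def relChains (F : Cl.{u} ⥤ ChainComplex (ModuleCat.{u} ℤ) ℕ) (X : Cl.{u}) (A : Set X) :
    ChainComplex (ModuleCat.{u} ℤ) ℕ :=
  cokernel (F.map (X.incl A))

/-- The chain map `F(Y,S) ⟶ F(X,A)` induced by a map of pairs `f : (Y,S) → (X,A)`. -/
def relChainsMap (F : Cl.{u} ⥤ ChainComplex (ModuleCat.{u} ℤ) ℕ) {Y X : Cl.{u}} (f : Y ⟶ X)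
    {S : Set Y} {A : Set X} (h : Set.MapsTo f.toFun S A) : relChains F Y S ⟶ relChains F X A :=
  cokernel.map _ _ (F.map (Cl.restrict f h)) (F.map f) (by
    rw [← F.map_comp, ← F.map_comp]
    rfl)

/-- The relative homology group `H_n(X,A)`. -/
def relHomology (F : Cl.{u} ⥤ ChainComplex (ModuleCat.{u} ℤ) ℕ) (X : Cl.{u}) (A : Set X) (n : ℕ) :
    ModuleCat.{u} ℤ :=
  (relChains F X A).homology n

/-- The map `H_n(Y,S) ⟶ H_n(X,A)` induced by a map of pairs `f : (Y,S) → (X,A)`. -/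
def relHomologyMap (F : Cl.{u} ⥤ ChainComplex (ModuleCat.{u} ℤ) ℕ) {Y X : Cl.{u}} (f : Y ⟶ X)
    {S : Set Y} {A : Set X} (h : Set.MapsTo f.toFun S A) (n : ℕ) :
    relHomology F Y S n ⟶ relHomology F X A n :=
  HomologicalComplex.homologyMap (relChainsMap F f h) n

/-- The inclusion `B → X` induces an isomorphism `H_n(B,S) ≅ H_n(X,A)`, where `S ⊆ B ⊆ X` and
`S ⊆ A ⊆ X`. -/
def InclusionInducesIso (F : Cl.{u} ⥤ ChainComplex (ModuleCat.{u} ℤ) ℕ) (X : Cl.{u})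
    (B S A : Set X) (h : S ⊆ A) (n : ℕ) : Prop :=
  IsIso (relHomologyMap F (X.incl B) (S := Subtype.val ⁻¹' S) (A := A) (fun _ hx => h hx) n)

end Pretop

end

open Pretop

universe w

noncomputable section

namespace Pretop

/-! ### A criterion for excision -/

section Criterion

variable {K L : ChainComplex (ModuleCat.{u} ℤ) ℕ}

/-! Excision for `(X, Z, A)` is excision for the interior cover formed by `A` and the complement of
`Z`. For an interior cover by `A` and `B`, the map `F(B)/F(A ∩ B) → F(X)/F(A)` is injective in each
degree, because a chain coming from both `A` and `B` comes from `A ∩ B`. Its cokernel is `F(X)/(F(A)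
+ F(B))`, so everything reduces to the acyclicity of that quotient: a chain whose boundary is small
(a sum of a chain in `A` and a chain in `B`) must be small up to a boundary.

For `J₊` and `J₁` every chain is already small. The simplices and cubes have a point `t` lying in
the closure of every other point; if `σ(t)` is in the interior of `A`, continuity forces all of `σ`
into `A` (`mem_smallChains_of_forall_mem_cl`).

For `I` one subdivides. The domain is a compact metric space, and a continuous map pulls interiors
in the closure space `X` back into topological interiors, so there is a Lebesgue number
(`exists_lebesgue_number`) and fine pieces are small. Subdivision is homotopic to the identity by
natural operators, `∂T = id - sd - T∂`; naturality keeps `T` of a small chain small, so `c` and its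
subdivision agree up to a boundary and a small chain whenever `∂c` is small.

Both homotopies are built on a universal model and transported along `σ`. For simplices, `sd` is
iterated barycentric subdivision, defined by coning from the barycentre, with mesh shrinking by
`n/(n+1)`. For cubes, `sd` cuts into a grid of `(k+1)^n` cells, and `T` comes from coning to the
origin; here one must also check that `T` kills degenerate cubes (`gridHomotopy_degenerate`). -/

theorem cokernel_π_f_surjective (f : K ⟶ L) (n : ℕ) :
    Function.Surjective ((cokernel.π f).f n) :=
  (ModuleCat.epi_iff_surjective _).mp inferInstance

theorem exists_of_cokernel_π_f_eq_zero (f : K ⟶ L) (n : ℕ) (x : L.X n)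
    (hx : (cokernel.π f).f n x = 0) : ∃ y, f.f n y = x := by
  have h := (ShortComplex.exact_cokernel f).map
    (HomologicalComplex.eval (ModuleCat.{u} ℤ) (ComplexShape.down ℕ) n)
  exact (ShortComplex.moduleCat_exact_iff _).mp h x hx

theorem cokernel_π_f_comp (f : K ⟶ L) (n : ℕ) (y : K.X n) :
    (cokernel.π f).f n (f.f n y) = 0 := by
  have h := HomologicalComplex.congr_hom (cokernel.condition f) n
  exact ConcreteCategory.congr_hom h y

theorem hom_f_d_apply (f : K ⟶ L) (i j : ℕ) (x : K.X i) :
    f.f j (K.d i j x) = L.d i j (f.f i x) :=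
  (ConcreteCategory.congr_hom (f.comm i j) x).symm

/-- A degreewise injective chain map whose cokernel is acyclic induces isomorphisms in homology. -/
theorem isIso_homologyMap_of_acyclic_cokernel (f : K ⟶ L)
    (hinj : ∀ n, Function.Injective (f.f n))
    (hac : ∀ (n : ℕ) (w : L.X n), (∃ k, L.d n (n - 1) w = f.f (n - 1) k) →
      ∃ v k, w = L.d (n + 1) n v + f.f n k) (n : ℕ) :
    IsIso (HomologicalComplex.homologyMap f n) := by
  have : ∀ n, Mono (f.f n) := fun n => (ModuleCat.mono_iff_injective _).mpr (hinj n)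
  have : Mono f := HomologicalComplex.mono_of_mono_f f inferInstance
  have hS : (ShortComplex.mk f (cokernel.π f) (cokernel.condition f)).ShortExact :=
    { exact := ShortComplex.exact_cokernel f }
  have hzero : ∀ m, IsZero ((cokernel f).homology m) := by
    intro m
    -- For `m = 0` the truncated index `m - 1` is again `0`, and the differential from degree `0` to
    -- itself is zero, so the condition on `d w` is then automatic.
    rw [← HomologicalComplex.exactAt_iff_isZero_homology,
      HomologicalComplex.exactAt_iff' _ (m + 1) m (m - 1) (by simp) (by cases m <;> simp),
      ShortComplex.moduleCat_exact_iff]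
    intro q hq
    obtain ⟨w, rfl⟩ := cokernel_π_f_surjective f m q
    obtain ⟨k, hk⟩ := exists_of_cokernel_π_f_eq_zero f (m - 1) (L.d m (m - 1) w) (by
      rw [hom_f_d_apply]; exact hq)
    obtain ⟨v, k', e⟩ := hac m w ⟨k, hk.symm⟩
    refine ⟨(cokernel.π f).f (m + 1) v, ?_⟩
    conv_rhs => rw [e, map_add, cokernel_π_f_comp, add_zero]
    exact (hom_f_d_apply _ _ _ _).symm
  have : Epi (HomologicalComplex.homologyMap f n) :=
    (hS.homology_exact₂ n).epi_f ((hzero n).eq_of_tgt _ _)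
  have : Mono (HomologicalComplex.homologyMap f n) :=
    (hS.homology_exact₁ (n + 1) n rfl).mono_g ((hzero (n + 1)).eq_of_src _ _)
  exact isIso_of_mono_of_epi _

end Criterion

/-- `hinter` gives injectivity of `F(B)/F(S) → F(X)/F(A)` in each degree. `hsmall` is the acyclicity
of its cokernel `F(X)/(F(A) + F(B))`, spelled out on representatives. -/
theorem inclusionInducesIso_of_small_chains (F : Cl.{u} ⥤ ChainComplex (ModuleCat.{u} ℤ) ℕ)
    (X : Cl.{u}) {A B S : Set X} (h : S ⊆ A)
    (hinter : ∀ (n : ℕ) (a : (F.obj (X.sub A)).X n) (b : (F.obj (X.sub B)).X n),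
      (F.map (X.incl B)).f n b = (F.map (X.incl A)).f n a →
      ∃ s, (F.map ((X.sub B).incl (Subtype.val ⁻¹' S))).f n s = b)
    (hsmall : ∀ (n : ℕ) (w : (F.obj X).X n),
      (∃ a b, (F.obj X).d n (n - 1) w =
        (F.map (X.incl A)).f (n - 1) a + (F.map (X.incl B)).f (n - 1) b) →
      ∃ v a b, w = (F.obj X).d (n + 1) n v +
        ((F.map (X.incl A)).f n a + (F.map (X.incl B)).f n b)) (n : ℕ) :
    InclusionInducesIso F X B S A h n := by
  have hπ : ∀ m b, (relChainsMap F (X.incl B) (S := Subtype.val ⁻¹' S) (A := A)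
      (fun _ hx => h hx)).f m ((cokernel.π (F.map ((X.sub B).incl _))).f m b) =
      (cokernel.π (F.map (X.incl A))).f m ((F.map (X.incl B)).f m b) := by
    intro m b
    have e : cokernel.π (F.map ((X.sub B).incl (Subtype.val ⁻¹' S))) ≫
        relChainsMap F (X.incl B) (S := Subtype.val ⁻¹' S) (A := A) (fun _ hx => h hx) =
        F.map (X.incl B) ≫ cokernel.π (F.map (X.incl A)) := cokernel.π_desc _ _ _
    exact ConcreteCategory.congr_hom (HomologicalComplex.congr_hom e m) b
  refine isIso_homologyMap_of_acyclic_cokernel _ ?_ ?_ n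
  · intro m
    rw [injective_iff_map_eq_zero]
    intro x hx
    obtain ⟨b, rfl⟩ := cokernel_π_f_surjective _ m x
    erw [hπ] at hx
    obtain ⟨a, ha⟩ := exists_of_cokernel_π_f_eq_zero _ m _ hx
    obtain ⟨s, rfl⟩ := hinter m a b ha.symm
    exact cokernel_π_f_comp _ _ _
  · rintro m q ⟨k, hk⟩
    obtain ⟨w, rfl⟩ := cokernel_π_f_surjective _ m q
    obtain ⟨b, rfl⟩ := cokernel_π_f_surjective _ _ k
    erw [hπ, ← hom_f_d_apply] at hk
    obtain ⟨a, ha⟩ := exists_of_cokernel_π_f_eq_zero _ (m - 1)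
      ((F.obj X).d m (m - 1) w - (F.map (X.incl B)).f (m - 1) b) (by
        rw [map_sub, sub_eq_zero]; exact hk)
    obtain ⟨v, a', b', e⟩ := hsmall m w ⟨a, b, by rw [ha, sub_add_cancel]⟩
    refine ⟨(cokernel.π (F.map (X.incl A))).f (m + 1) v,
      (cokernel.π (F.map ((X.sub B).incl (Subtype.val ⁻¹' S)))).f m b', ?_⟩
    erw [hπ, ← hom_f_d_apply]
    conv_lhs => rw [e]
    rw [map_add, map_add, cokernel_π_f_comp, zero_add]
    rfl

/-! ### Maps into subspaces and small chains -/

namespace Cl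

/-- A continuous map with values in `A` is a continuous map to the subspace `A`. -/
def Map.codRestrict {K : Cl.{v}} {X : Cl.{u}} (σ : Map K X) (A : Set X) (h : ∀ x, σ x ∈ A) :
    Map K (X.sub A) where
  toFun := fun x => ⟨σ x, h x⟩
  cont := by
    rintro S _ ⟨x, hx, rfl⟩
    change σ x ∈ X.cl (Subtype.val '' ((fun x => (⟨σ x, h x⟩ : A)) '' S))
    rw [Set.image_image]
    exact σ.cont S ⟨x, hx, rfl⟩

/-- A continuous map between topological spaces, as a map of closure spaces. -/
def Map.ofContinuous {Y Z : Type*} [TopologicalSpace Y] [TopologicalSpace Z] (f : Y → Z)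
    (hf : Continuous f) : Map (ofTop Y) (ofTop Z) :=
  ⟨f, fun _ => image_closure_subset_closure_image hf⟩

/-- If `σ y` were outside `A`, then `σ x`, being in the closure of `σ y`, would be in the closure of
the complement of `A`. -/
theorem Map.mem_of_mem_cl {K : Cl.{v}} {X : Cl.{u}} (σ : Map K X) {A : Set X} {x y : K}
    (hx : σ x ∈ X.int A) (h : x ∈ K.cl {y}) : σ y ∈ A := by
  by_contra hy
  refine hx (X.cl_mono ?_ (σ.cont {y} ⟨x, h, rfl⟩))
  rintro _ ⟨z, rfl, rfl⟩
  exact hy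

theorem isInteriorCover_pair_iff {X : Cl.{u}} {A B : Set X} :
    X.IsInteriorCover {A, B} ↔ ∀ x, x ∈ X.int A ∨ x ∈ X.int B := by
  simp [IsInteriorCover, Set.eq_univ_iff_forall]

/-- The Lebesgue number lemma for a map from a compact metric space to a closure space. -/
theorem Map.exists_lebesgue_number {Y : Type v} [PseudoMetricSpace Y] [CompactSpace Y]
    {X : Cl.{u}} {A B : Set X} (hAB : X.IsInteriorCover {A, B}) (σ : Map (ofTop Y) X) :
    ∃ δ > 0, ∀ y : Y, (∀ z ∈ Metric.ball y δ, σ z ∈ A) ∨ (∀ z ∈ Metric.ball y δ, σ z ∈ B) := by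
  -- In `X` the set `int U` need not be open, as closure is not idempotent; but its preimage lies in
  -- the topological interior of the preimage of `U`, so these open interiors cover `Y`.
  have key : ∀ (U : Set X) (y : Y), σ y ∈ X.int U → y ∈ interior (σ.toFun ⁻¹' U) := by
    intro U y hy
    rw [interior_eq_compl_closure_compl]
    intro hc
    exact hy (X.cl_mono (by rintro _ ⟨z, hz, rfl⟩; exact hz) (σ.cont _ ⟨y, hc, rfl⟩))
  obtain ⟨δ, hδ, h⟩ := lebesgue_number_lemma_of_metric (s := (Set.univ : Set Y))
    (c := fun b : Bool => interior (σ.toFun ⁻¹' (bif b then A else B))) isCompact_univ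
    (fun _ => isOpen_interior) (fun y _ => by
      rcases isInteriorCover_pair_iff.mp hAB (σ y) with hy | hy
      · exact Set.mem_iUnion.mpr ⟨true, key _ _ hy⟩
      · exact Set.mem_iUnion.mpr ⟨false, key _ _ hy⟩)
  refine ⟨δ, hδ, fun y => ?_⟩
  obtain ⟨b, hb⟩ := h y trivial
  cases b with
  | true => exact Or.inl fun z hz => (interior_subset (hb hz) : z ∈ σ.toFun ⁻¹' _)
  | false => exact Or.inr fun z hz => (interior_subset (hb hz) : z ∈ σ.toFun ⁻¹' _)

end Cl

section SmallChains

open Cl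

variable {K : Cl.{v}} {X : Cl.{u}}

/-- The map on free abelian groups of maps given by postcomposition. -/
def pushforward (K : Cl.{v}) {Y : Cl.{w}} (f : Map X Y) : (Map K X →₀ ℤ) →ₗ[ℤ] (Map K Y →₀ ℤ) :=
  Finsupp.lmapDomain ℤ ℤ (fun σ : Map K X => f.comp σ)

@[simp]
theorem pushforward_single {Y : Cl.{w}} (f : Map X Y) (σ : Map K X) (r : ℤ) :
    pushforward K f (Finsupp.single σ r) = Finsupp.single (f.comp σ) r :=
  Finsupp.mapDomain_single

open Classical in
/-- The left inverse of the inclusion of chains which discards the maps not landing in `A`. -/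
def corestrict (K : Cl.{v}) (A : Set X) : (Map K X →₀ ℤ) →ₗ[ℤ] (Map K (X.sub A) →₀ ℤ) :=
  Finsupp.linearCombination ℤ (fun σ : Map K X =>
    if h : ∀ x, σ x ∈ A then Finsupp.single (σ.codRestrict A h) 1 else 0)

theorem corestrict_single_of_mem {A : Set X} (σ : Map K X) (h : ∀ x, σ x ∈ A) (r : ℤ) :
    corestrict K A (Finsupp.single σ r) = Finsupp.single (σ.codRestrict A h) r := by
  simp [corestrict, h]

theorem corestrict_single_of_not_mem {A : Set X} (σ : Map K X) (h : ¬ ∀ x, σ x ∈ A) (r : ℤ) :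
    corestrict K A (Finsupp.single σ r) = 0 := by
  rw [corestrict, Finsupp.linearCombination_single, dif_neg h, smul_zero]

theorem corestrict_pushforward_incl {A : Set X} (c : Map K (X.sub A) →₀ ℤ) :
    corestrict K A (pushforward K (X.incl A) c) = c := by
  have : corestrict K A ∘ₗ pushforward K (X.incl A) = LinearMap.id := by
    apply Finsupp.lhom_ext
    intro σ r
    rw [LinearMap.comp_apply, pushforward_single,
      corestrict_single_of_mem _ (fun x => (σ x).2)]
    rfl
  exact LinearMap.congr_fun this c

/-- Discarding the maps not landing in `B` turns a chain of `A` into a chain of `A ∩ B`. -/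
theorem corestrict_pushforward_mem_range {A B : Set X} (a : Map K (X.sub A) →₀ ℤ) :
    ∃ s, pushforward K ((X.sub B).incl (Subtype.val ⁻¹' (A ∩ B))) s =
      corestrict K B (pushforward K (X.incl A) a) := by
  change _ ∈ LinearMap.range (pushforward K ((X.sub B).incl (Subtype.val ⁻¹' (A ∩ B))))
  induction a using Finsupp.induction_linear with
  | zero => simp
  | add f g hf hg => simpa only [map_add] using Submodule.add_mem _ hf hg
  | single σ r =>
    rw [pushforward_single]
    by_cases h : ∀ x, (Map.comp (X.incl A) σ) x ∈ B
    · rw [corestrict_single_of_mem _ h]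
      refine ⟨Finsupp.single (((Map.comp (X.incl A) σ).codRestrict B h).codRestrict _
        fun x => ⟨(σ x).2, h x⟩) r, ?_⟩
      rw [pushforward_single]
      rfl
    · rw [corestrict_single_of_not_mem _ h]
      exact Submodule.zero_mem _

/-- The chains on maps which land in `A` or in `B`. -/
def smallChains (K : Cl.{v}) (A B : Set X) : Submodule ℤ (Map K X →₀ ℤ) :=
  Finsupp.supported ℤ ℤ {σ | (∀ x, σ x ∈ A) ∨ ∀ x, σ x ∈ B}

theorem single_mem_smallChains {A B : Set X} {σ : Map K X}
    (h : (∀ x, σ x ∈ A) ∨ ∀ x, σ x ∈ B) (r : ℤ) : Finsupp.single σ r ∈ smallChains K A B :=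
  Finsupp.single_mem_supported ℤ r h

theorem mem_smallChains_iff {A B : Set X} {c : Map K X →₀ ℤ} : c ∈ smallChains K A B ↔
    ∃ a b, c = pushforward K (X.incl A) a + pushforward K (X.incl B) b := by
  constructor
  · intro h
    change c ∈ Finsupp.supported ℤ ℤ _ at h
    rw [Finsupp.supported_eq_span_single] at h
    suffices c ∈ LinearMap.range (pushforward K (X.incl A)) ⊔
        LinearMap.range (pushforward K (X.incl B)) by
      obtain ⟨_, ⟨a, rfl⟩, _, ⟨b, rfl⟩, e⟩ := Submodule.mem_sup.mp this
      exact ⟨a, b, e.symm⟩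
    refine Submodule.span_le.mpr ?_ h
    rintro _ ⟨σ, hσ | hσ, rfl⟩
    · refine Submodule.mem_sup_left ⟨Finsupp.single (σ.codRestrict A hσ) 1, ?_⟩
      rw [pushforward_single]
      rfl
    · refine Submodule.mem_sup_right ⟨Finsupp.single (σ.codRestrict B hσ) 1, ?_⟩
      rw [pushforward_single]
      rfl
  · rintro ⟨a, b, rfl⟩
    refine Submodule.add_mem _ ?_ ?_
    · induction a using Finsupp.induction_linear with
      | zero => simp
      | add f g hf hg => simpa only [map_add] using Submodule.add_mem _ hf hg
      | single σ r =>
        rw [pushforward_single]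
        exact single_mem_smallChains (Or.inl fun x => (σ x).2) r
    · induction b using Finsupp.induction_linear with
      | zero => simp
      | add f g hf hg => simpa only [map_add] using Submodule.add_mem _ hf hg
      | single σ r =>
        rw [pushforward_single]
        exact single_mem_smallChains (Or.inr fun x => (σ x).2) r

/-- A linear map sends small chains into a submodule as soon as it does so for small maps. -/
theorem map_mem_of_mem_smallChains {A B : Set X} {M : Type*} [AddCommGroup M]
    (φ : (Map K X →₀ ℤ) →ₗ[ℤ] M) (N : Submodule ℤ M)
    (h : ∀ σ : Map K X, ((∀ x, σ x ∈ A) ∨ ∀ x, σ x ∈ B) → φ (Finsupp.single σ 1) ∈ N)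
    {c : Map K X →₀ ℤ} (hc : c ∈ smallChains K A B) : φ c ∈ N := by
  change c ∈ Finsupp.supported ℤ ℤ _ at hc
  rw [Finsupp.supported_eq_span_single] at hc
  change c ∈ N.comap φ
  refine Submodule.span_le.mpr ?_ hc
  rintro _ ⟨σ, hσ, rfl⟩
  exact h σ hσ

/-- If `K` has a point in the closure of every point, all chains are small. -/
theorem mem_smallChains_of_forall_mem_cl {A B : Set X} (hAB : X.IsInteriorCover {A, B}) (t : K)
    (ht : ∀ y, t ∈ K.cl {y}) (c : Map K X →₀ ℤ) : c ∈ smallChains K A B := by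
  induction c using Finsupp.induction_linear with
  | zero => exact Submodule.zero_mem _
  | add f g hf hg => exact Submodule.add_mem _ hf hg
  | single σ r =>
    refine single_mem_smallChains ?_ r
    rcases isInteriorCover_pair_iff.mp hAB (σ t) with h | h
    · exact Or.inl fun y => σ.mem_of_mem_cl h (ht y)
    · exact Or.inr fun y => σ.mem_of_mem_cl h (ht y)

end SmallChains

namespace IntervalObj

open Cl
open scoped Simplicial

/-! ### Reduction of excision to small chains -/

/-- The boundary of singular simplicial chains. -/
def simplicialBoundary (J : IntervalObj) (n : ℕ) (X : Cl.{u}) :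
    (Map (J.simplex.obj ⦋n + 1⦌) X →₀ ℤ) →ₗ[ℤ] (Map (J.simplex.obj ⦋n⦌) X →₀ ℤ) :=
  ∑ i : Fin (n + 2), (-1 : ℤ) ^ (i : ℕ) •
    Finsupp.lmapDomain ℤ ℤ (fun σ : Map (J.simplex.obj ⦋n + 1⦌) X =>
      σ.comp (J.simplex.map (SimplexCategory.δ i)))

theorem simplicialChains_d_apply (J : IntervalObj) (n : ℕ) (X : Cl.{u})
    (c : Map (J.simplex.obj ⦋n + 1⦌) X →₀ ℤ) :
    (J.simplicialChains.obj X).d (n + 1) n c = J.simplicialBoundary n X c := by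
  have h : (J.simplicialChains.obj X).d (n + 1) n =
      ModuleCat.ofHom (J.simplicialBoundary n X) := by
    refine (AlgebraicTopology.AlternatingFaceMapComplex.obj_d_eq _ n).trans ?_
    ext : 1
    simp only [simplicialBoundary, ModuleCat.hom_sum, ModuleCat.hom_zsmul]
    rfl
  exact ConcreteCategory.congr_hom h c

/-- A chain `b` of `B` is recovered from its image in `X` by `corestrict`; if that image also comes
from `A`, the recovered chain lies in `A ∩ B`. Degree `0` is separate because there is no boundary
condition there. -/
theorem inclusionInducesIso_simplicialChains (J : IntervalObj) (X : Cl.{u}) {A B : Set X}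
    (h0 : ∀ c : Map (J.simplex.obj ⦋0⦌) X →₀ ℤ, c ∈ smallChains _ A B)
    (hs : ∀ (n : ℕ) (c : Map (J.simplex.obj ⦋n + 1⦌) X →₀ ℤ),
      J.simplicialBoundary n X c ∈ smallChains _ A B →
        ∃ v, c - J.simplicialBoundary (n + 1) X v ∈ smallChains _ A B) (n : ℕ) :
    InclusionInducesIso J.simplicialChains X B (A ∩ B) A Set.inter_subset_left n := by
  refine inclusionInducesIso_of_small_chains _ _ _ ?_ ?_ n
  · intro n a b hab
    obtain ⟨s, hs⟩ := corestrict_pushforward_mem_range (K := J.simplex.obj ⦋n⦌) (B := B) a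
    refine ⟨s, hs.trans ?_⟩
    refine (congrArg (corestrict (J.simplex.obj ⦋n⦌) B) hab).symm.trans ?_
    exact corestrict_pushforward_incl b
  · intro n w hw
    cases n with
    | zero =>
      obtain ⟨a, b, e⟩ := mem_smallChains_iff.mp (h0 w)
      exact ⟨0, a, b, by rw [map_zero, zero_add]; exact e⟩
    | succ n =>
      obtain ⟨a, b, e⟩ := hw
      obtain ⟨v, hv⟩ := hs n w (mem_smallChains_iff.mpr ⟨a, b,
        (J.simplicialChains_d_apply n X w).symm.trans e⟩)
      obtain ⟨a', b', e'⟩ := mem_smallChains_iff.mp hv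
      refine ⟨v, a', b', ?_⟩
      erw [simplicialChains_d_apply]
      exact sub_eq_iff_eq_add'.mp e'

/-- If `τ` composed with a projection takes values in `A`, so does `τ`, because the projection has a
coface as a section. Hence the retraction onto chains of `A` survives normalization. -/
theorem corestrict_mem_degenerateChains (J : IntervalObj) {n : ℕ} {X : Cl.{u}} (A : Set X)
    {c : J.cubicalFree n X} (hc : c ∈ J.degenerateChains n X) :
    (corestrict (J.cube n) A c : J.cubicalFree n (X.sub A)) ∈ J.degenerateChains n (X.sub A) := by
  change c ∈ (J.degenerateChains n (X.sub A)).comap (corestrict (J.cube n) A)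
  refine Submodule.span_le.mpr ?_ hc
  rintro _ ⟨σ, hσ, rfl⟩
  change corestrict (J.cube n) A _ ∈ J.degenerateChains n (X.sub A)
  by_cases h : ∀ x, σ x ∈ A
  · rw [corestrict_single_of_mem _ h]
    refine Submodule.subset_span ⟨_, ?_, rfl⟩
    cases n with
    | zero => exact hσ
    | succ n =>
      obtain ⟨i, τ, rfl⟩ := hσ
      refine ⟨i, τ.codRestrict A fun x => ?_, rfl⟩
      have := h (J.coface i false x)
      have e := congrArg (fun f => τ (f.toFun x)) (J.codegeneracy_comp_coface_self i false)
      exact e ▸ this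
  · rw [corestrict_single_of_not_mem _ h]
    exact Submodule.zero_mem _

theorem cubicalChains_d_apply (J : IntervalObj) (n : ℕ) (X : Cl.{u}) (c : J.cubicalFree (n + 1) X) :
    (J.cubicalChains.obj X).d (n + 1) n ((J.degenerateChains (n + 1) X).mkQ c) =
      (J.degenerateChains n X).mkQ (J.cubicalBoundary n X c) := by
  have h : (J.cubicalChains.obj X).d (n + 1) n = ModuleCat.ofHom (Submodule.mapQ _ _
      (J.cubicalBoundary n X) (J.cubicalBoundary_degenerate n X)) := by
    change (J.cubicalComplex X).d (n + 1) n = _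
    simp only [cubicalComplex, ChainComplex.of_d]
  exact ConcreteCategory.congr_hom h _

/-- Smallness of a normalized class means smallness of a representative modulo degenerate chains,
whence the suprema. -/
theorem inclusionInducesIso_cubicalChains (J : IntervalObj) (X : Cl.{u}) {A B : Set X}
    (h0 : ∀ c : J.cubicalFree 0 X, c ∈ smallChains _ A B ⊔ J.degenerateChains 0 X)
    (hs : ∀ (n : ℕ) (c : J.cubicalFree (n + 1) X),
      J.cubicalBoundary n X c ∈ smallChains _ A B ⊔ J.degenerateChains n X →
        ∃ v, c - J.cubicalBoundary (n + 1) X v ∈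
          smallChains _ A B ⊔ J.degenerateChains (n + 1) X) (n : ℕ) :
    InclusionInducesIso J.cubicalChains X B (A ∩ B) A Set.inter_subset_left n := by
  have hsmall : ∀ n (c : J.cubicalFree n X), c ∈ smallChains _ A B ⊔ J.degenerateChains n X ↔
      ∃ (a : J.cubicalFree n (X.sub A)) (b : J.cubicalFree n (X.sub B)),
        (J.degenerateChains n X).mkQ c = (J.degenerateChains n X).mkQ
          (pushforward _ (X.incl A) a + pushforward _ (X.incl B) b) := by
    intro n c
    constructor
    · intro h
      obtain ⟨s, hs, d, hd, rfl⟩ := Submodule.mem_sup.mp h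
      obtain ⟨a, b, rfl⟩ := mem_smallChains_iff.mp hs
      refine ⟨a, b, (Submodule.Quotient.eq _).mpr ?_⟩
      rwa [add_sub_cancel_left]
    · rintro ⟨a, b, e⟩
      have := (Submodule.Quotient.eq _).mp e
      rw [← add_sub_cancel (pushforward _ (X.incl A) a + pushforward _ (X.incl B) b) c]
      exact Submodule.add_mem_sup (mem_smallChains_iff.mpr ⟨a, b, rfl⟩) this
  refine inclusionInducesIso_of_small_chains _ _ _ ?_ ?_ n
  · intro n a b hab
    obtain ⟨a, rfl⟩ := Submodule.mkQ_surjective _ a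
    obtain ⟨b, rfl⟩ := Submodule.mkQ_surjective _ b
    obtain ⟨s, hs⟩ := corestrict_pushforward_mem_range (K := J.cube n) (B := B) a
    refine ⟨(J.degenerateChains n _).mkQ s, ?_⟩
    have h1 := (Submodule.Quotient.eq _).mp hab
    have h2 := J.corestrict_mem_degenerateChains B h1
    rw [map_sub] at h2
    refine ((Submodule.Quotient.eq _).mpr ?_).symm
    have h3 : corestrict (J.cube n) B (J.cubicalFreeMap n (X.incl B) b) = b :=
      corestrict_pushforward_incl b
    rw [h3] at h2
    exact hs ▸ h2
  · intro n w hw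
    obtain ⟨w, rfl⟩ := Submodule.mkQ_surjective _ w
    cases n with
    | zero =>
      obtain ⟨a, b, e⟩ := (hsmall 0 w).mp (h0 w)
      exact ⟨0, (J.degenerateChains 0 _).mkQ a, (J.degenerateChains 0 _).mkQ b, by
        rw [map_zero, zero_add]; exact e⟩
    | succ n =>
      obtain ⟨a, b, e⟩ := hw
      obtain ⟨a, rfl⟩ := Submodule.mkQ_surjective _ a
      obtain ⟨b, rfl⟩ := Submodule.mkQ_surjective _ b
      obtain ⟨v, hv⟩ := hs n w ((hsmall n _).mpr ⟨a, b,
        (J.cubicalChains_d_apply n X w).symm.trans e⟩)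
      obtain ⟨a', b', e'⟩ := (hsmall (n + 1) _).mp hv
      refine ⟨(J.degenerateChains (n + 2) X).mkQ v, (J.degenerateChains (n + 1) _).mkQ a',
        (J.degenerateChains (n + 1) _).mkQ b', ?_⟩
      erw [cubicalChains_d_apply]
      rw [map_sub] at e'
      exact sub_eq_iff_eq_add'.mp e'

/-! ### The finite interval objects -/

/-- The last vertex lies above every vertex, hence in the closure of each. -/
theorem simplex_plus_mem_cl (n : ℕ) (y : plus.simplex.obj ⦋n⦌) :
    (Fin.last n : plus.simplex.obj ⦋n⦌) ∈ (plus.simplex.obj ⦋n⦌).cl {y} :=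
  ⟨y, rfl, Fin.le_last (n := n) y⟩

theorem simplex_one_mem_cl (n : ℕ) (y : one.simplex.obj ⦋n⦌) :
    (Fin.last n : one.simplex.obj ⦋n⦌) ∈ (one.simplex.obj ⦋n⦌).cl {y} :=
  ⟨y, rfl⟩

/-- A neighbourhood of `t` contains every point of `J`, so a product neighbourhood of the constant
point `t` contains every `y`. -/
theorem cube_mem_cl (J : IntervalObj) (t : J.space) (ht : ∀ y, t ∈ J.space.cl {y}) (n : ℕ)
    (y : J.cube n) : (fun _ => t : J.cube n) ∈ (J.cube n).cl {y} := by
  intro V _ hV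
  refine ⟨y, rfl, fun i => ?_⟩
  by_contra hy
  exact hV i (J.space.cl_mono (Set.singleton_subset_iff.mpr hy) (ht (y i)))

theorem inclusionInducesIso_of_simplex_mem_cl (J : IntervalObj) (t : ∀ n, J.simplex.obj ⦋n⦌)
    (ht : ∀ n y, t n ∈ (J.simplex.obj ⦋n⦌).cl {y}) (X : Cl.{u}) {A B : Set X}
    (hAB : X.IsInteriorCover {A, B}) (n : ℕ) :
    InclusionInducesIso J.simplicialChains X B (A ∩ B) A Set.inter_subset_left n :=
  J.inclusionInducesIso_simplicialChains X
    (mem_smallChains_of_forall_mem_cl hAB _ (ht 0))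
    (fun n _ _ => ⟨0, mem_smallChains_of_forall_mem_cl hAB _ (ht (n + 1)) _⟩) n

theorem inclusionInducesIso_of_space_mem_cl (J : IntervalObj) (t : J.space)
    (ht : ∀ y, t ∈ J.space.cl {y}) (X : Cl.{u}) {A B : Set X}
    (hAB : X.IsInteriorCover {A, B}) (n : ℕ) :
    InclusionInducesIso J.cubicalChains X B (A ∩ B) A Set.inter_subset_left n :=
  J.inclusionInducesIso_cubicalChains X
    (fun _ => Submodule.mem_sup_left
      (mem_smallChains_of_forall_mem_cl hAB _ (J.cube_mem_cl t ht 0) _))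
    (fun n _ _ => ⟨0, Submodule.mem_sup_left
      (mem_smallChains_of_forall_mem_cl hAB _ (J.cube_mem_cl t ht (n + 1)) _)⟩) n

end IntervalObj

/-! ### Chains of ordered vertices and barycentric subdivision -/

/-- The free abelian group on the `(n+1)`-tuples of elements of `V`. -/
abbrev VertexChains (V : Type*) (n : ℕ) : Type _ := (Fin (n + 1) → V) →₀ ℤ

namespace VertexChains

variable {V W : Type*}

/-- The map induced by a map of vertices. -/
def map (g : V → W) (n : ℕ) : VertexChains V n →ₗ[ℤ] VertexChains W n :=
  Finsupp.lmapDomain ℤ ℤ (fun w => g ∘ w)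

@[simp]
theorem map_single (g : V → W) (n : ℕ) (w : Fin (n + 1) → V) (r : ℤ) :
    map g n (Finsupp.single w r) = Finsupp.single (g ∘ w) r :=
  Finsupp.mapDomain_single

/-- The simplicial boundary. -/
def boundary (V : Type*) (n : ℕ) : VertexChains V (n + 1) →ₗ[ℤ] VertexChains V n :=
  ∑ i : Fin (n + 2), (-1 : ℤ) ^ (i : ℕ) •
    Finsupp.lmapDomain ℤ ℤ (fun w : Fin (n + 2) → V => w ∘ i.succAbove)

theorem boundary_single (n : ℕ) (w : Fin (n + 2) → V) (r : ℤ) :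
    boundary V n (Finsupp.single w r) =
      ∑ i : Fin (n + 2), (-1 : ℤ) ^ (i : ℕ) • Finsupp.single (w ∘ i.succAbove) r := by
  simp [boundary, LinearMap.sum_apply, Finsupp.mapDomain_single]

theorem map_boundary (g : V → W) (n : ℕ) (c : VertexChains V (n + 1)) :
    map g n (boundary V n c) = boundary W n (map g (n + 1) c) := by
  induction c using Finsupp.induction_linear with
  | zero => simp
  | add c d hc hd => simp only [map_add, hc, hd]
  | single w r =>
    rw [boundary_single, map_single, boundary_single, map_sum]
    exact Finset.sum_congr rfl fun i _ => by rw [map_smul, map_single]; rfl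

/-- The cone over a chain with apex `v`. -/
def cone (v : V) (n : ℕ) : VertexChains V n →ₗ[ℤ] VertexChains V (n + 1) :=
  Finsupp.lmapDomain ℤ ℤ (fun w => (Fin.cons v w : Fin (n + 2) → V))

@[simp]
theorem cone_single (v : V) (n : ℕ) (w : Fin (n + 1) → V) (r : ℤ) :
    cone v n (Finsupp.single w r) = Finsupp.single (Fin.cons v w) r :=
  Finsupp.mapDomain_single

theorem map_cone (g : V → W) (v : V) (n : ℕ) (c : VertexChains V n) :
    map g (n + 1) (cone v n c) = cone (g v) n (map g n c) := by
  induction c using Finsupp.induction_linear with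
  | zero => simp
  | add c d hc hd => simp only [map_add, hc, hd]
  | single w r =>
    rw [cone_single, map_single, map_single, cone_single, Fin.comp_cons]

/-- The face opposite the apex is the chain itself; the other faces are cones over faces, with the
index and hence the sign shifted by one. The formula starts in degree `1`: on vertices there would
be an extra term at the apex. -/
theorem boundary_cone (v : V) (n : ℕ) (c : VertexChains V (n + 1)) :
    boundary V (n + 1) (cone v (n + 1) c) = c - cone v n (boundary V n c) := by
  induction c using Finsupp.induction_linear with
  | zero => simp
  | add c d hc hd => simp only [map_add, hc, hd]; abel
  | single w r =>
    rw [cone_single, boundary_single, boundary_single, Fin.sum_univ_succ, sub_eq_add_neg]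
    congr 1
    · simp only [Fin.val_zero, pow_zero, one_smul]
      congr 1
    · rw [map_sum, ← Finset.sum_neg_distrib]
      refine Finset.sum_congr rfl fun i _ => ?_
      rw [map_smul, cone_single, Fin.val_succ, pow_succ, mul_neg_one, neg_smul]
      congr 3
      funext j
      refine Fin.cases ?_ (fun j => ?_) j
      · simp
      · simp

/-- Checked by hand, since `boundary_cone` does not reach degree `0`. -/
theorem boundary_boundary_single_zero (w : Fin 3 → V) (r : ℤ) :
    boundary V 0 (boundary V 1 (Finsupp.single w r)) = 0 := by
  have e : ∀ (i : Fin 3) (j : Fin 2), (w ∘ i.succAbove) ∘ j.succAbove =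
      fun _ : Fin 1 => w (i.succAbove (j.succAbove 0)) := by
    intro i j
    funext k
    rw [Subsingleton.elim k 0]
    rfl
  rw [(boundary_single 1 w r).trans (Fin.sum_univ_three _)]
  have h : ∀ v : Fin 2 → V, boundary V 0 (Finsupp.single v r) = _ := fun v =>
    (boundary_single 0 v r).trans (Fin.sum_univ_two _)
  simp only [map_add, map_smul, h, e]
  simp [Fin.succAbove]
  abel

/-- Every tuple is the cone over its tail, and `∂∂(cone c) = ∂c - ∂(cone ∂c) = cone ∂∂c`. -/
theorem boundary_boundary (n : ℕ) (c : VertexChains V (n + 2)) :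
    boundary V n (boundary V (n + 1) c) = 0 := by
  induction n with
  | zero =>
    induction c using Finsupp.induction_linear with
    | zero => simp
    | add c d hc hd => simp only [map_add, hc, hd, add_zero]
    | single w r => exact boundary_boundary_single_zero w r
  | succ n ih =>
    induction c using Finsupp.induction_linear with
    | zero => simp
    | add c d hc hd => simp only [map_add, hc, hd, add_zero]
    | single w r =>
      rw [← Fin.cons_self_tail w, ← cone_single, boundary_cone, map_sub, boundary_cone, ih]
      simp

/-- Barycentric subdivision, for a given choice of barycentres. -/
def subdivision (b : ∀ n, (Fin (n + 1) → V) → V) :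
    ∀ n, (VertexChains V n →ₗ[ℤ] VertexChains V n)
  | 0 => LinearMap.id
  | n + 1 => Finsupp.linearCombination ℤ (fun w =>
      cone (b (n + 1) w) n (subdivision b n (boundary V n (Finsupp.single w 1))))

/-- The chain homotopy between barycentric subdivision and the identity. -/
def homotopy (b : ∀ n, (Fin (n + 1) → V) → V) :
    ∀ n, (VertexChains V n →ₗ[ℤ] VertexChains V (n + 1))
  | 0 => 0
  | n + 1 => Finsupp.linearCombination ℤ (fun w => cone (b (n + 1) w) (n + 1)
      (Finsupp.single w 1 - homotopy b n (boundary V n (Finsupp.single w 1))))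

section

variable (b : ∀ n, (Fin (n + 1) → V) → V)

theorem subdivision_succ_single (n : ℕ) (w : Fin (n + 2) → V) :
    subdivision b (n + 1) (Finsupp.single w 1) =
      cone (b (n + 1) w) n (subdivision b n (boundary V n (Finsupp.single w 1))) := by
  rw [subdivision, Finsupp.linearCombination_single, one_smul]

theorem homotopy_succ_single (n : ℕ) (w : Fin (n + 2) → V) :
    homotopy b (n + 1) (Finsupp.single w 1) = cone (b (n + 1) w) (n + 1)
      (Finsupp.single w 1 - homotopy b n (boundary V n (Finsupp.single w 1))) := by
  rw [homotopy, Finsupp.linearCombination_single, one_smul]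

theorem linearMap_ext {n : ℕ} {M : Type*} [AddCommGroup M] {φ ψ : VertexChains V n →ₗ[ℤ] M}
    (h : ∀ w, φ (Finsupp.single w 1) = ψ (Finsupp.single w 1)) : φ = ψ :=
  Finsupp.lhom_ext' fun w => LinearMap.ext_ring (h w)

theorem boundary_homotopy_zero (c : VertexChains V 0) :
    boundary V 0 (homotopy b 0 c) = c - subdivision b 0 c := by
  simp [homotopy, subdivision]

/-- Write `T` for the homotopy. By the cone formula `∂Tw = (w - T∂w) - cone(∂w - ∂T∂w)`. By
induction and `∂∂ = 0`, the bracket is `sd ∂w`, whose cone is `sd w`. No property of the chosen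
points `b` enters. -/
theorem boundary_homotopy_succ (n : ℕ) (c : VertexChains V (n + 1)) :
    boundary V (n + 1) (homotopy b (n + 1) c) =
      c - subdivision b (n + 1) c - homotopy b n (boundary V n c) := by
  induction n with
  | zero =>
    refine LinearMap.congr_fun (f := boundary V 1 ∘ₗ homotopy b 1)
      (g := LinearMap.id - subdivision b 1 - homotopy b 0 ∘ₗ boundary V 0)
      (linearMap_ext fun w => ?_) c
    simp only [LinearMap.comp_apply, LinearMap.sub_apply, LinearMap.id_apply]
    rw [homotopy_succ_single, boundary_cone, subdivision_succ_single, map_sub (boundary V 0),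
      boundary_homotopy_zero]
    simp only [sub_sub_cancel]
    abel
  | succ n ih =>
    refine LinearMap.congr_fun (f := boundary V (n + 2) ∘ₗ homotopy b (n + 2))
      (g := LinearMap.id - subdivision b (n + 2) - homotopy b (n + 1) ∘ₗ boundary V (n + 1))
      (linearMap_ext fun w => ?_) c
    simp only [LinearMap.comp_apply, LinearMap.sub_apply, LinearMap.id_apply]
    rw [homotopy_succ_single, boundary_cone, subdivision_succ_single,
      map_sub (boundary V (n + 1)), ih, boundary_boundary]
    simp only [map_zero, sub_zero, sub_sub_cancel]
    abel

/-- Applied to affine maps, which preserve barycentres; this naturality lets the operators pass to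
singular chains. -/
theorem map_subdivision (b' : ∀ n, (Fin (n + 1) → W) → W) (g : V → W)
    (hg : ∀ n w, g (b n w) = b' n (g ∘ w)) (n : ℕ) (c : VertexChains V n) :
    map g n (subdivision b n c) = subdivision b' n (map g n c) := by
  induction n with
  | zero => rfl
  | succ n ih =>
    refine LinearMap.congr_fun (f := map g (n + 1) ∘ₗ subdivision b (n + 1))
      (g := subdivision b' (n + 1) ∘ₗ map g (n + 1)) (linearMap_ext fun w => ?_) c
    simp only [LinearMap.comp_apply]
    rw [subdivision_succ_single, map_cone, ih, map_boundary, hg, map_single,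
      subdivision_succ_single]

theorem map_homotopy (b' : ∀ n, (Fin (n + 1) → W) → W) (g : V → W)
    (hg : ∀ n w, g (b n w) = b' n (g ∘ w)) (n : ℕ) (c : VertexChains V n) :
    map g (n + 1) (homotopy b n c) = homotopy b' n (map g n c) := by
  induction n with
  | zero => simp [homotopy]
  | succ n ih =>
    refine LinearMap.congr_fun (f := map g (n + 2) ∘ₗ homotopy b (n + 1))
      (g := homotopy b' (n + 1) ∘ₗ map g (n + 1)) (linearMap_ext fun w => ?_) c
    simp only [LinearMap.comp_apply]
    rw [homotopy_succ_single, map_cone, map_sub, ih, map_boundary, hg, map_single,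
      homotopy_succ_single]

end

end VertexChains

/-! ### Affine simplices -/

/-- The standard simplex of dimension `n`. -/
abbrev Simp (n : ℕ) : Type := stdSimplex ℝ (Fin (n + 1))

namespace Simp

variable {m n : ℕ}

/-- The affine map between standard simplices with prescribed vertices. -/
def aff (w : Fin (m + 1) → Simp n) (x : Simp m) : Simp n :=
  ⟨∑ i, x.1 i • (w i).1,
    (convex_stdSimplex ℝ _).sum_mem (fun i _ => stdSimplex.zero_le x i)
      (stdSimplex.sum_eq_one x) (fun i _ => (w i).2)⟩

theorem aff_coe (w : Fin (m + 1) → Simp n) (x : Simp m) :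
    (aff w x).1 = ∑ i, x.1 i • (w i).1 := rfl

theorem continuous_aff (w : Fin (m + 1) → Simp n) : Continuous (aff w) := by
  refine Continuous.subtype_mk (continuous_finsetSum _ fun i _ => ?_) _
  exact ((continuous_apply i).comp continuous_subtype_val).smul continuous_const

theorem aff_vertex (w : Fin (m + 1) → Simp n) (i : Fin (m + 1)) :
    aff w (stdSimplex.vertex i) = w i := by
  apply Subtype.ext
  rw [aff_coe, Finset.sum_eq_single i]
  · simp
  · intro j _ hj
    simp [Pi.single_eq_of_ne hj]
  · simp

theorem aff_comp {k : ℕ} (w : Fin (m + 1) → Simp n) (v : Fin (k + 1) → Simp m) (x : Simp k) :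
    aff w (aff v x) = aff (aff w ∘ v) x := by
  apply Subtype.ext
  have h : ∀ j, (aff v x).1 j = ∑ i, x.1 i * (v i).1 j := by
    intro j
    rw [aff_coe, Finset.sum_apply]
    rfl
  simp only [aff_coe, Function.comp_apply, h, Finset.sum_smul, Finset.smul_sum, smul_smul]
  exact Finset.sum_comm

theorem aff_vertices (x : Simp n) : aff stdSimplex.vertex x = x := by
  apply Subtype.ext
  funext j
  rw [aff_coe, Finset.sum_apply, Finset.sum_eq_single j]
  · simp
  · intro i _ hi
    simp [Pi.single_eq_of_ne hi.symm]
  · simp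

/-- Brings the face maps of the singular complex into the affine calculus. -/
theorem map_eq_aff (f : Fin (m + 1) → Fin (n + 1)) (x : Simp m) :
    stdSimplex.map f x = aff (fun i => stdSimplex.vertex (f i)) x := by
  apply Subtype.ext
  funext j
  change FunOnFinite.linearMap ℝ ℝ f x j = _
  rw [FunOnFinite.linearMap_apply_apply, aff_coe, Finset.sum_apply, Finset.sum_filter]
  refine Finset.sum_congr rfl fun i _ => ?_
  simp only [Pi.smul_apply, Pi.single_apply, smul_eq_mul, mul_ite, mul_one, mul_zero, eq_comm (a := j)]
  rfl

theorem aff_mem_of_convex {P : Set (Fin (n + 1) → ℝ)} (hP : Convex ℝ P)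
    {w : Fin (m + 1) → Simp n} (hw : ∀ i, (w i).1 ∈ P) (x : Simp m) :
    (aff w x).1 ∈ P :=
  hP.sum_mem (fun i _ => stdSimplex.zero_le x i) (stdSimplex.sum_eq_one x) fun i _ => hw i

/-- The barycentre of the affine simplex with vertices `w`. -/
def bary (m : ℕ) (w : Fin (m + 1) → Simp n) : Simp n := aff w stdSimplex.barycenter

theorem aff_bary {k : ℕ} (w : Fin (m + 1) → Simp n) (v : Fin (k + 1) → Simp m) :
    aff w (bary k v) = bary k (aff w ∘ v) :=
  aff_comp _ _ _

/-- The vector from the barycentre to `w i` is the mean of the `m + 1` differences `w i - w j`. The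
term `j = i` vanishes, and each of the other `m` has norm at most `δ`. -/
theorem dist_bary_le {w : Fin (m + 1) → Simp n} {δ : ℝ}
    (hw : ∀ i j, dist (w i) (w j) ≤ δ) (i : Fin (m + 1)) :
    dist (w i) (bary m w) ≤ m / (m + 1) * δ := by
  have hm : (0 : ℝ) < m + 1 := by positivity
  have e : (w i).1 - (bary m w).1 =
      ∑ j, ((m : ℝ) + 1)⁻¹ • ((w i).1 - (w j).1) := by
    rw [bary, aff_coe, ← Finset.smul_sum, Finset.sum_sub_distrib, smul_sub]
    congr 1
    · simp [← Nat.cast_smul_eq_nsmul ℝ, smul_smul, inv_mul_cancel₀ hm.ne']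
    · rw [Finset.smul_sum]
      refine Finset.sum_congr rfl fun j _ => ?_
      congr 1
      change (Fintype.card (Fin (m + 1)) : ℝ)⁻¹ = _
      simp
  rw [Subtype.dist_eq, dist_eq_norm, e]
  refine (norm_sum_le _ _).trans ?_
  rw [← Finset.add_sum_erase _ _ (Finset.mem_univ i)]
  have h1 : ∀ j ∈ Finset.univ.erase i,
      ‖((m : ℝ) + 1)⁻¹ • ((w i).1 - (w j).1)‖ ≤ ((m : ℝ) + 1)⁻¹ * δ := by
    intro j _
    rw [norm_smul, Real.norm_of_nonneg (by positivity), ← dist_eq_norm]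
    exact mul_le_mul_of_nonneg_left (hw i j) (by positivity)
  have h2 := Finset.sum_le_sum h1
  rw [Finset.sum_const, Finset.card_erase_of_mem (Finset.mem_univ i), Finset.card_univ,
    Fintype.card_fin, Nat.add_sub_cancel, nsmul_eq_mul] at h2
  rw [sub_self, smul_zero, norm_zero, zero_add]
  exact h2.trans_eq (by ring)

/-- The tuples of vertices in `P` of mutual distance at most `δ`. -/
def fine (P : Set (Fin (n + 1) → ℝ)) (δ : ℝ) (m : ℕ) : Set (Fin (m + 1) → Simp n) :=
  {w | (∀ i, (w i).1 ∈ P) ∧ ∀ i j, dist (w i) (w j) ≤ δ}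

/-- The only new distances are those to the apex, and they are controlled because `P` lies in a ball
around it. -/
theorem cone_mem_supported_fine {P Q : Set (Fin (n + 1) → ℝ)} {δ : ℝ} {v : Simp n}
    (hPQ : P ⊆ Q) (hv : v.1 ∈ Q) (hδ : 0 ≤ δ)
    (hd : P ⊆ Metric.closedBall v.1 δ)
    {c : VertexChains (Simp n) m} (hc : c ∈ Finsupp.supported ℤ ℤ (fine (n := n) P δ m)) :
    VertexChains.cone v m c ∈ Finsupp.supported ℤ ℤ (fine Q δ (m + 1)) := by
  rw [Finsupp.supported_eq_span_single] at hc
  change c ∈ (Finsupp.supported ℤ ℤ (fine Q δ (m + 1))).comap (VertexChains.cone v m)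
  refine Submodule.span_le.mpr ?_ hc
  rintro _ ⟨w, ⟨hw, hw'⟩, rfl⟩
  change VertexChains.cone v m _ ∈ Finsupp.supported ℤ ℤ (fine Q δ (m + 1))
  rw [VertexChains.cone_single]
  have hd' : ∀ i, dist (w i) v ≤ δ := fun i => hd (hw i)
  refine Finsupp.single_mem_supported ℤ 1
    (show _ ∈ fine Q δ (m + 1) from ⟨fun i => ?_, fun i j => ?_⟩)
  · refine Fin.cases hv (fun i => hPQ (hw i)) i
  · refine Fin.cases ?_ (fun i => ?_) i <;> refine Fin.cases ?_ (fun j => ?_) j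
    · simpa using hδ
    · simpa [dist_comm] using hd' j
    · simpa using hd' i
    · simpa using hw' i j

/-- The convex set `P` is there for the induction. The ball of radius `r * δ` about the barycentre
is convex and contains all vertices of `w`, so it contains the vertices of the subdivided faces;
this bounds the edges at the cone point. The edges inside the faces are bounded by induction. -/
theorem subdivision_single_mem_supported_fine {n : ℕ} {r δ : ℝ} (hδ : 0 ≤ δ) (hr0 : 0 ≤ r)
    (hr : (m : ℝ) / (m + 1) ≤ r) {P : Set (Fin (n + 1) → ℝ)} (hP : Convex ℝ P)
    {w : Fin (m + 1) → Simp n} (hw : w ∈ fine P δ m) :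
    VertexChains.subdivision (V := Simp n) bary m (Finsupp.single w 1) ∈
      Finsupp.supported ℤ ℤ (fine (n := n) P (r * δ) m) := by
  induction m generalizing P with
  | zero =>
    refine Finsupp.single_mem_supported ℤ 1 (show w ∈ fine P (r * δ) 0 from ⟨hw.1, fun i j => ?_⟩)
    rw [show i = j from Fin.ext (by omega), dist_self]
    positivity
  | succ m ih =>
    rw [VertexChains.subdivision_succ_single]
    set b := bary (m + 1) w
    refine cone_mem_supported_fine
      (P := P ∩ Metric.closedBall b.1 (r * δ)) Set.inter_subset_left
      (aff_mem_of_convex hP hw.1 _) (by positivity) Set.inter_subset_right ?_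
    rw [VertexChains.boundary_single, map_sum]
    refine Submodule.sum_mem _ fun i _ => ?_
    rw [map_smul]
    refine Submodule.smul_mem _ _ (ih (le_trans ?_ hr)
      (hP.inter (convex_closedBall _ _)) ⟨fun j => ⟨hw.1 _, ?_⟩, fun j k => hw.2 _ _⟩)
    -- The ratio for the faces, `m/(m+1)`, is at most `(m+1)/(m+2)`, so the same `r` serves in every
    -- lower dimension.
    · rw [div_le_div_iff₀ (by positivity) (by positivity)]
      push_cast
      nlinarith
    · exact (dist_bary_le hw.2 _).trans (mul_le_mul_of_nonneg_right hr hδ)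

theorem subdivision_mem_supported_fine {r δ : ℝ} (hδ : 0 ≤ δ) (hr0 : 0 ≤ r)
    (hr : (m : ℝ) / (m + 1) ≤ r) {c : VertexChains (Simp n) m}
    (hc : c ∈ Finsupp.supported ℤ ℤ (fine (n := n) Set.univ δ m)) :
    VertexChains.subdivision (V := Simp n) bary m c ∈
      Finsupp.supported ℤ ℤ (fine (n := n) Set.univ (r * δ) m) := by
  rw [Finsupp.supported_eq_span_single] at hc
  change c ∈ (Finsupp.supported ℤ ℤ _).comap (VertexChains.subdivision bary m)
  refine Submodule.span_le.mpr ?_ hc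
  rintro _ ⟨w, hw, rfl⟩
  exact subdivision_single_mem_supported_fine hδ hr0 hr convex_univ hw

theorem dist_aff_le {w : Fin (m + 1) → Simp n} {δ : ℝ} (hw : ∀ i j, dist (w i) (w j) ≤ δ)
    (x : Simp m) : dist (aff w x) (w 0) ≤ δ :=
  aff_mem_of_convex (convex_closedBall (w 0).1 δ) (fun i => hw i 0) x

end Simp

/-! ### Subdivision of singular simplices -/

section SingularSubdivision

open Cl IntervalObj
open scoped Simplicial

/-- The standard simplex as a closure space. -/
abbrev simpSpace (n : ℕ) : Cl.{0} := unit.simplex.obj ⦋n⦌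

/-- The affine map with prescribed vertices, as a map of closure spaces. -/
def affMap {m n : ℕ} (w : Fin (m + 1) → Simp n) : Map (simpSpace m) (simpSpace n) :=
  Map.ofContinuous (Simp.aff w) (Simp.continuous_aff w)

/-- The free abelian group on the singular simplices of a closure space. -/
abbrev SingularChains (n : ℕ) (X : Cl.{u}) : Type u := Map (simpSpace n) X →₀ ℤ

variable {X : Cl.{u}} {m n : ℕ}

/-- The singular chain obtained by restricting `σ` to the affine simplices of a chain. -/
def affChains (σ : Map (simpSpace n) X) (m : ℕ) :
    VertexChains (Simp n) m →ₗ[ℤ] SingularChains m X :=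
  Finsupp.lmapDomain ℤ ℤ (fun w => σ.comp (affMap w))

theorem affChains_single (σ : Map (simpSpace n) X) (w : Fin (m + 1) → Simp n) (r : ℤ) :
    affChains σ m (Finsupp.single w r) = Finsupp.single (σ.comp (affMap w)) r :=
  Finsupp.mapDomain_single

theorem affMap_vertices : affMap (n := n) stdSimplex.vertex = Map.id _ :=
  Map.ext (funext Simp.aff_vertices)

theorem affMap_comp {k : ℕ} (w : Fin (m + 1) → Simp n) (v : Fin (k + 1) → Simp m) :
    (affMap w).comp (affMap v) = affMap (Simp.aff w ∘ v) :=
  Map.ext (funext (Simp.aff_comp w v))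

theorem simplex_map_δ (i : Fin (n + 2)) : unit.simplex.map (SimplexCategory.δ i) =
    affMap (fun j => stdSimplex.vertex (i.succAbove j)) :=
  Map.ext (funext (Simp.map_eq_aff i.succAbove))

/-- The identity affine simplex. -/
def fundamental (n : ℕ) : VertexChains (Simp n) n := Finsupp.single stdSimplex.vertex 1

theorem affChains_fundamental (σ : Map (simpSpace n) X) :
    affChains σ n (fundamental n) = Finsupp.single σ 1 := by
  rw [fundamental, affChains_single, affMap_vertices]
  rfl

theorem simplicialBoundary_single (σ : Map (simpSpace (n + 1)) X) (r : ℤ) :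
    unit.simplicialBoundary n X (Finsupp.single σ r) = ∑ i : Fin (n + 2), (-1 : ℤ) ^ (i : ℕ) •
      Finsupp.single (σ.comp (unit.simplex.map (SimplexCategory.δ i))) r := by
  simp only [simplicialBoundary, LinearMap.sum_apply, LinearMap.smul_apply]
  exact Finset.sum_congr rfl fun i _ => congrArg _ Finsupp.mapDomain_single

theorem simplicialBoundary_affChains (σ : Map (simpSpace n) X)
    (c : VertexChains (Simp n) (m + 1)) :
    unit.simplicialBoundary m X (affChains σ (m + 1) c) =
      affChains σ m (VertexChains.boundary _ m c) := by
  induction c using Finsupp.induction_linear with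
  | zero => simp
  | add c d hc hd => simp only [map_add, hc, hd]
  | single w r =>
    rw [affChains_single, simplicialBoundary_single, VertexChains.boundary_single, map_sum]
    refine Finset.sum_congr rfl fun i _ => ?_
    rw [map_smul, affChains_single, simplex_map_δ]
    congr 2
    change σ.comp ((affMap w).comp (affMap _)) = _
    rw [affMap_comp]
    congr 2
    funext j
    exact Simp.aff_vertex w _

/-- The operation on singular chains induced by an operation on chains of affine simplices. -/
def inducedOp (X : Cl.{u}) (φ : VertexChains (Simp n) n →ₗ[ℤ] VertexChains (Simp n) m) :
    SingularChains n X →ₗ[ℤ] SingularChains m X :=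
  Finsupp.linearCombination ℤ (fun σ => affChains σ m (φ (fundamental n)))

theorem inducedOp_single (φ : VertexChains (Simp n) n →ₗ[ℤ] VertexChains (Simp n) m)
    (σ : Map (simpSpace n) X) :
    inducedOp X φ (Finsupp.single σ 1) = affChains σ m (φ (fundamental n)) := by
  rw [inducedOp, Finsupp.linearCombination_single, one_smul]

theorem affChains_comp {k : ℕ} (σ : Map (simpSpace k) X) (w : Fin (n + 1) → Simp k)
    (c : VertexChains (Simp n) m) :
    affChains (σ.comp (affMap w)) m c =
      affChains σ m (VertexChains.map (Simp.aff w) m c) := by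
  induction c using Finsupp.induction_linear with
  | zero => simp
  | add c d hc hd => simp only [map_add, hc, hd]
  | single v r =>
    rw [affChains_single, VertexChains.map_single, affChains_single, ← affMap_comp]
    rfl

/-- An operation which is natural for affine maps commutes with restriction to affine simplices. -/
theorem inducedOp_affChains {k : ℕ}
    (φ : ∀ k, VertexChains (Simp k) n →ₗ[ℤ] VertexChains (Simp k) m)
    (hφ : ∀ k (w : Fin (n + 1) → Simp k) (c : VertexChains (Simp n) n),
      VertexChains.map (Simp.aff w) m (φ n c) = φ k (VertexChains.map (Simp.aff w) n c))
    (σ : Map (simpSpace k) X) (c : VertexChains (Simp k) n) :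
    inducedOp X (φ n) (affChains σ n c) = affChains σ m (φ k c) := by
  refine LinearMap.congr_fun (f := inducedOp X (φ n) ∘ₗ affChains σ n)
    (g := affChains σ m ∘ₗ φ k) (VertexChains.linearMap_ext fun w => ?_) c
  simp only [LinearMap.comp_apply]
  rw [affChains_single, inducedOp_single, affChains_comp, hφ, fundamental,
    VertexChains.map_single]
  congr 3
  funext i
  exact Simp.aff_vertex w i

theorem inducedOp_mem_smallChains {A B : Set X}
    (φ : VertexChains (Simp n) n →ₗ[ℤ] VertexChains (Simp n) m)
    {c : SingularChains n X} (hc : c ∈ smallChains (simpSpace n) A B) :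
    inducedOp X φ c ∈ smallChains (simpSpace m) A B := by
  refine map_mem_of_mem_smallChains _ _ (fun σ hσ => ?_) hc
  rw [inducedOp_single]
  induction φ (fundamental n) using Finsupp.induction_linear with
  | zero => simp
  | add c d hc hd => simpa only [map_add] using Submodule.add_mem _ hc hd
  | single w r =>
    rw [affChains_single]
    exact single_mem_smallChains (hσ.imp (fun h x => h _) (fun h x => h _)) r

/-- Barycentric subdivision of singular chains. -/
def singularSubdivision (n : ℕ) (X : Cl.{u}) : SingularChains n X →ₗ[ℤ] SingularChains n X :=
  inducedOp X (VertexChains.subdivision Simp.bary n)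

/-- The chain homotopy between barycentric subdivision of singular chains and the identity. -/
def singularHomotopy (n : ℕ) (X : Cl.{u}) : SingularChains n X →ₗ[ℤ] SingularChains (n + 1) X :=
  inducedOp X (VertexChains.homotopy Simp.bary n)

theorem singularSubdivision_affChains {k : ℕ} (σ : Map (simpSpace k) X)
    (c : VertexChains (Simp k) n) :
    singularSubdivision n X (affChains σ n c) =
      affChains σ n (VertexChains.subdivision Simp.bary n c) :=
  inducedOp_affChains (fun k => VertexChains.subdivision (V := Simp k) Simp.bary n)
    (fun _ w c => VertexChains.map_subdivision _ _ _ (fun _ v => Simp.aff_bary w v) n c) σ c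

theorem singularHomotopy_affChains {k : ℕ} (σ : Map (simpSpace k) X)
    (c : VertexChains (Simp k) n) :
    singularHomotopy n X (affChains σ n c) =
      affChains σ (n + 1) (VertexChains.homotopy Simp.bary n c) :=
  inducedOp_affChains (fun k => VertexChains.homotopy (V := Simp k) Simp.bary n)
    (fun _ w c => VertexChains.map_homotopy _ _ _ (fun _ v => Simp.aff_bary w v) n c) σ c

/-- Each singular simplex is the image of the identity simplex of its model, so identities between
natural operators need only be checked on vertex chains. -/
theorem singularChains_hom_ext {M : Type*} [AddCommGroup M]
    {φ ψ : SingularChains n X →ₗ[ℤ] M}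
    (h : ∀ σ, φ (affChains σ n (fundamental n)) = ψ (affChains σ n (fundamental n))) : φ = ψ :=
  Finsupp.lhom_ext' fun σ => LinearMap.ext_ring (by
    have := h σ
    rwa [affChains_fundamental] at this)

theorem boundary_singularHomotopy (n : ℕ) (c : SingularChains (n + 1) X) :
    unit.simplicialBoundary (n + 1) X (singularHomotopy (n + 1) X c) =
      c - singularSubdivision (n + 1) X c -
        singularHomotopy n X (unit.simplicialBoundary n X c) := by
  refine LinearMap.congr_fun
    (f := unit.simplicialBoundary (n + 1) X ∘ₗ singularHomotopy (n + 1) X)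
    (g := LinearMap.id - singularSubdivision (n + 1) X -
      singularHomotopy n X ∘ₗ unit.simplicialBoundary n X)
    (singularChains_hom_ext fun σ => ?_) c
  simp only [LinearMap.comp_apply, LinearMap.sub_apply, LinearMap.id_apply]
  rw [singularHomotopy_affChains, simplicialBoundary_affChains, singularSubdivision_affChains,
    simplicialBoundary_affChains, singularHomotopy_affChains, ← map_sub, ← map_sub,
    VertexChains.boundary_homotopy_succ]

/-- Substitute `sd = id - T∂ - ∂T`: both `∂ sd` and `sd ∂` become `∂ - ∂T∂`. -/
theorem boundary_vertexSubdivision {V : Type*} (b : ∀ n, (Fin (n + 1) → V) → V) (n : ℕ)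
    (c : VertexChains V (n + 1)) :
    VertexChains.boundary V n (VertexChains.subdivision b (n + 1) c) =
      VertexChains.subdivision b n (VertexChains.boundary V n c) := by
  have h := VertexChains.boundary_homotopy_succ b n c
  have h' : VertexChains.subdivision b (n + 1) c =
      c - VertexChains.homotopy b n (VertexChains.boundary V n c) -
        VertexChains.boundary V (n + 1) (VertexChains.homotopy b (n + 1) c) := by
    rw [h]; abel
  rw [h', map_sub, map_sub, VertexChains.boundary_boundary, sub_zero]
  cases n with
  | zero =>
    rw [VertexChains.boundary_homotopy_zero, sub_sub_cancel]
  | succ n =>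
    rw [VertexChains.boundary_homotopy_succ, VertexChains.boundary_boundary, map_zero, sub_zero,
      sub_sub_cancel]

theorem boundary_singularSubdivision (n : ℕ) (c : SingularChains (n + 1) X) :
    unit.simplicialBoundary n X (singularSubdivision (n + 1) X c) =
      singularSubdivision n X (unit.simplicialBoundary n X c) := by
  refine LinearMap.congr_fun
    (f := unit.simplicialBoundary n X ∘ₗ singularSubdivision (n + 1) X)
    (g := singularSubdivision n X ∘ₗ unit.simplicialBoundary n X)
    (singularChains_hom_ext fun σ => ?_) c
  simp only [LinearMap.comp_apply]
  rw [singularSubdivision_affChains, simplicialBoundary_affChains, simplicialBoundary_affChains,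
    singularSubdivision_affChains, boundary_vertexSubdivision]

/-! ### Iterated subdivisions become small -/

theorem singularSubdivision_iterate_single (σ : Map (simpSpace n) X) (k : ℕ) :
    (singularSubdivision n X)^[k] (Finsupp.single σ 1) =
      affChains σ n ((VertexChains.subdivision Simp.bary n)^[k] (fundamental n)) := by
  induction k with
  | zero => exact (affChains_fundamental σ).symm
  | succ k ih =>
    rw [Function.iterate_succ_apply', ih, singularSubdivision_affChains,
      Function.iterate_succ_apply']

theorem subdivision_iterate_fundamental_mem (n k : ℕ) :
    (VertexChains.subdivision Simp.bary n)^[k] (fundamental n) ∈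
      Finsupp.supported ℤ ℤ (Simp.fine (n := n) Set.univ
        (((n : ℝ) / (n + 1)) ^ k * Metric.diam (Set.univ : Set (Simp n))) n) := by
  induction k with
  | zero =>
    refine Finsupp.single_mem_supported ℤ 1 (show _ ∈ Simp.fine Set.univ _ n from
      ⟨fun _ => trivial, fun i j => ?_⟩)
    rw [pow_zero, one_mul]
    exact Metric.dist_le_diam_of_mem isCompact_univ.isBounded trivial trivial
  | succ k ih =>
    rw [Function.iterate_succ_apply', pow_succ', mul_assoc]
    exact Simp.subdivision_mem_supported_fine
      (mul_nonneg (by positivity) Metric.diam_nonneg) (by positivity) le_rfl ih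

/-- After `k` steps the edges are at most `(n/(n+1))^k` times the diameter, eventually below the
Lebesgue number. Asking for all `k ≥ N` allows finitely many simplices to be treated with one `k`.
-/
theorem exists_subdivision_single_mem_smallChains {A B : Set X}
    (hAB : X.IsInteriorCover {A, B}) (σ : Map (simpSpace n) X) :
    ∃ N, ∀ k ≥ N, (singularSubdivision n X)^[k] (Finsupp.single σ 1) ∈
      smallChains (simpSpace n) A B := by
  obtain ⟨δ, hδ, hL⟩ := Map.exists_lebesgue_number (Y := Simp n) hAB σ
  have hlim : Filter.Tendsto (fun k : ℕ => ((n : ℝ) / (n + 1)) ^ k *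
      Metric.diam (Set.univ : Set (Simp n))) Filter.atTop (nhds 0) := by
    rw [← zero_mul (Metric.diam (Set.univ : Set (Simp n)))]
    refine (tendsto_pow_atTop_nhds_zero_of_lt_one (by positivity) ?_).mul_const _
    rw [div_lt_one (by positivity)]
    exact lt_add_one _
  obtain ⟨N, hN⟩ := Filter.eventually_atTop.mp (hlim.eventually (gt_mem_nhds hδ))
  refine ⟨N, fun k hk => ?_⟩
  rw [singularSubdivision_iterate_single]
  have hmem := subdivision_iterate_fundamental_mem n k
  rw [Finsupp.supported_eq_span_single] at hmem
  change _ ∈ (smallChains (simpSpace n) A B).comap (affChains σ n)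
  refine Submodule.span_le.mpr ?_ hmem
  rintro _ ⟨w, hw, rfl⟩
  change affChains σ n _ ∈ smallChains (simpSpace n) A B
  rw [affChains_single]
  have hball : ∀ x : Simp n, Simp.aff w x ∈ Metric.ball (w 0) δ := fun x =>
    (Simp.dist_aff_le hw.2 x).trans_lt (hN k hk)
  exact single_mem_smallChains
    ((hL (w 0)).imp (fun h x => h _ (hball x)) (fun h x => h _ (hball x))) 1

theorem exists_subdivision_mem_smallChains {A B : Set X} (hAB : X.IsInteriorCover {A, B})
    (c : SingularChains n X) :
    ∃ N, ∀ k ≥ N, (singularSubdivision n X)^[k] c ∈ smallChains (simpSpace n) A B := by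
  simp only [← Module.End.coe_pow]
  induction c using Finsupp.induction_linear with
  | zero => exact ⟨0, fun k _ => by rw [map_zero]; exact Submodule.zero_mem _⟩
  | add c d hc hd =>
    obtain ⟨N, hN⟩ := hc
    obtain ⟨M, hM⟩ := hd
    refine ⟨max N M, fun k hk => ?_⟩
    rw [map_add]
    exact Submodule.add_mem _ (hN k (le_of_max_le_left hk)) (hM k (le_of_max_le_right hk))
  | single σ r =>
    obtain ⟨N, hN⟩ := exists_subdivision_single_mem_smallChains hAB σ
    refine ⟨N, fun k hk => ?_⟩
    rw [← Finsupp.smul_single_one, map_smul, Module.End.coe_pow]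
    exact Submodule.smul_mem _ _ (hN k hk)

/-- Telescoping: `c - sd c = ∂Tc + T∂c`, where `T∂c` is small because `∂c` is; then repeat with `sd
c`, whose boundary `sd ∂c` is again small. -/
theorem exists_sub_boundary_iterate_mem {A B : Set X} (k : ℕ) (c : SingularChains (n + 1) X)
    (hc : unit.simplicialBoundary n X c ∈ smallChains (simpSpace n) A B) :
    ∃ v, c - (singularSubdivision (n + 1) X)^[k] c - unit.simplicialBoundary (n + 1) X v ∈
      smallChains (simpSpace (n + 1)) A B := by
  induction k generalizing c with
  | zero => exact ⟨0, by simp⟩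
  | succ k ih =>
    obtain ⟨v, hv⟩ := ih (singularSubdivision (n + 1) X c) (by
      rw [boundary_singularSubdivision]
      exact inducedOp_mem_smallChains _ hc)
    refine ⟨v + singularHomotopy (n + 1) X c, ?_⟩
    rw [Function.iterate_succ_apply, map_add, boundary_singularHomotopy]
    have h := Submodule.add_mem _ hv
      (inducedOp_mem_smallChains (VertexChains.homotopy Simp.bary n) hc)
    convert h using 1
    change _ = _ + singularHomotopy n X _
    abel

theorem inclusionInducesIso_simplicialChains_unit (X : Cl.{u}) {A B : Set X}
    (hAB : X.IsInteriorCover {A, B}) (n : ℕ) :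
    InclusionInducesIso unit.simplicialChains X B (A ∩ B) A Set.inter_subset_left n := by
  refine unit.inclusionInducesIso_simplicialChains X ?_ ?_ n
  · intro c
    -- On points subdivision does nothing, so a small iterate is the chain itself.
    have hid : singularSubdivision 0 X = LinearMap.id :=
      singularChains_hom_ext fun σ => singularSubdivision_affChains σ _
    obtain ⟨N, hN⟩ := exists_subdivision_mem_smallChains hAB c
    have := hN N le_rfl
    rwa [hid, LinearMap.id_coe, Function.iterate_id] at this
  · intro n c hc
    obtain ⟨N, hN⟩ := exists_subdivision_mem_smallChains hAB c
    obtain ⟨v, hv⟩ := exists_sub_boundary_iterate_mem N c hc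
    refine ⟨v, ?_⟩
    convert Submodule.add_mem _ hv (hN N le_rfl) using 1
    abel

end SingularSubdivision

/-! ### Subdivision of singular cubes -/

section CubicalSubdivision

open Cl IntervalObj

/-! ### The product closure on cubes is the topological one -/

theorem mem_closure_cube_iff {n : ℕ} {A : Set (Fin n → unitInterval)} {x : Fin n → unitInterval} :
    x ∈ closure A ↔ ∀ V : Fin n → Set unitInterval, (∀ i, x i ∈ (closure (V i)ᶜ)ᶜ) →
      ∃ a ∈ A, ∀ i, a i ∈ V i := by
  simp only [← interior_eq_compl_closure_compl, mem_interior_iff_mem_nhds]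
  rw [mem_closure_iff_nhds]
  constructor
  · intro hx V hV
    obtain ⟨a, ha, haA⟩ := hx (Set.univ.pi V) (set_pi_mem_nhds Set.finite_univ fun i _ => hV i)
    exact ⟨a, haA, fun i => ha i trivial⟩
  · intro hx U hU
    rw [nhds_pi, Filter.mem_pi] at hU
    obtain ⟨I, -, t, ht, hU⟩ := hU
    obtain ⟨a, ha, hat⟩ := hx t ht
    exact ⟨a, hU fun i _ => hat i, ha⟩

theorem cube_unit_cl (n : ℕ) (A : Set (Fin n → unitInterval)) :
    (unit.cube n).cl A = closure A := by
  apply Set.Subset.antisymm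
  · exact fun x hx => mem_closure_cube_iff.mpr fun V hV => hx V (Set.toFinite _) hV
  · exact fun x hx V _ hV => (mem_closure_cube_iff (x := x)).mp hx V hV

/-- A continuous map between topological cubes, as a map of closure spaces. -/
def cubeMap {m n : ℕ} (f : (Fin m → unitInterval) → (Fin n → unitInterval))
    (hf : Continuous f) : Map (unit.cube m) (unit.cube n) where
  toFun := f
  cont A := by
    have h : ∀ A, f '' closure A ⊆ closure (f '' A) :=
      fun A => image_closure_subset_closure_image hf
    simp only [← cube_unit_cl] at h
    exact h A

/-- Needed to cone off an arbitrary singular cube of a cube, where joint continuity of a product is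
used. -/
theorem continuous_of_cubeMap {m n : ℕ} (f : Map (unit.cube m) (unit.cube n)) :
    Continuous (X := Fin m → unitInterval) (Y := Fin n → unitInterval) f.toFun := by
  refine continuous_iff_image_closure_subset_closure_image.mpr fun {A} => ?_
  rw [← cube_unit_cl, ← cube_unit_cl]
  exact f.cont A

/-- The comparison of the topological cube with the product closure. -/
def toCube (n : ℕ) : Map (ofTop (Fin n → unitInterval)) (unit.cube n) where
  toFun x := x
  cont A := by
    rintro _ ⟨x, hx, rfl⟩
    have h : x ∈ (unit.cube n).cl A := (cube_unit_cl n A).symm.subset hx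
    refine (unit.cube n).cl_mono ?_ h
    exact fun a ha => ⟨a, ha, rfl⟩

/-- The group of normalized singular cubical chains. -/
abbrev CubicalChains (n : ℕ) (X : Cl.{u}) : Type u :=
  unit.cubicalFree n X ⧸ unit.degenerateChains n X

variable {X : Cl.{u}} {Y : Cl.{v}} {m n : ℕ}

/-! ### Normalized cubical chains and natural operations -/

theorem cubicalFree_hom_ext {M : Type*} [AddCommGroup M]
    {φ ψ : unit.cubicalFree n X →ₗ[ℤ] M}
    (h : ∀ σ, φ (Finsupp.single σ 1) = ψ (Finsupp.single σ 1)) : φ = ψ :=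
  Finsupp.lhom_ext' fun σ => LinearMap.ext_ring (h σ)

theorem degenerateChains_le {M : Submodule ℤ (unit.cubicalFree (n + 1) X)}
    (h : ∀ (i : Fin (n + 1)) (τ : unit.Cube n X),
      Finsupp.single (τ.comp (unit.codegeneracy i)) 1 ∈ M) :
    unit.degenerateChains (n + 1) X ≤ M := by
  refine Submodule.span_le.mpr ?_
  rintro _ ⟨σ, ⟨i, τ, rfl⟩, rfl⟩
  exact h i τ

theorem degenerateChains_zero (X : Cl.{u}) : unit.degenerateChains 0 X = ⊥ := by
  refine Submodule.span_eq_bot.mpr ?_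
  rintro _ ⟨σ, hσ, rfl⟩
  exact hσ.elim

theorem single_codegeneracy_mem (i : Fin (n + 1)) (τ : unit.Cube n X) (r : ℤ) :
    Finsupp.single (τ.comp (unit.codegeneracy i)) r ∈ unit.degenerateChains (n + 1) X := by
  rw [← Finsupp.smul_single_one]
  exact Submodule.smul_mem _ _ (Submodule.subset_span ⟨_, ⟨i, τ, rfl⟩, rfl⟩)

theorem cubicalBoundary_single (σ : unit.Cube (n + 1) X) (r : ℤ) :
    unit.cubicalBoundary n X (Finsupp.single σ r) = ∑ i : Fin (n + 1),
      (-1 : ℤ) ^ ((i : ℕ) + 1) • (Finsupp.single (σ.comp (unit.coface i false)) r -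
        Finsupp.single (σ.comp (unit.coface i true)) r) := by
  simp only [cubicalBoundary, LinearMap.sum_apply, LinearMap.smul_apply, LinearMap.sub_apply,
    faceChain_single]

theorem pushforward_cubicalBoundary (f : Map Y X) (c : unit.cubicalFree (n + 1) Y) :
    pushforward _ f (unit.cubicalBoundary n Y c) =
      unit.cubicalBoundary n X (pushforward _ f c) := by
  refine LinearMap.congr_fun (f := pushforward _ f ∘ₗ unit.cubicalBoundary n Y)
    (g := unit.cubicalBoundary n X ∘ₗ pushforward _ f) (cubicalFree_hom_ext fun σ => ?_) c
  simp only [LinearMap.comp_apply, pushforward_single, cubicalBoundary_single, map_sum, map_smul,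
    map_sub]
  rfl

theorem pushforward_mem_degenerateChains (f : Map Y X) :
    unit.degenerateChains n Y ≤ (unit.degenerateChains n X).comap (pushforward (unit.cube n) f) := by
  cases n with
  | zero => rw [degenerateChains_zero]; exact bot_le
  | succ n =>
    refine degenerateChains_le fun i τ => ?_
    change pushforward _ f _ ∈ unit.degenerateChains (n + 1) X
    rw [pushforward_single]
    exact single_codegeneracy_mem i (f.comp τ) 1

/-- The map induced on normalized cubical chains. -/
def cubicalPush (n : ℕ) (f : Map Y X) : CubicalChains n Y →ₗ[ℤ] CubicalChains n X :=
  Submodule.mapQ _ _ (pushforward (unit.cube n) f) (pushforward_mem_degenerateChains f)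

/-- The boundary of normalized cubical chains. -/
def cubicalD (n : ℕ) (X : Cl.{u}) : CubicalChains (n + 1) X →ₗ[ℤ] CubicalChains n X :=
  Submodule.mapQ _ _ (unit.cubicalBoundary n X) (unit.cubicalBoundary_degenerate n X)

/-- The projection to normalized chains. -/
abbrev normalize (n : ℕ) (X : Cl.{u}) : unit.cubicalFree n X →ₗ[ℤ] CubicalChains n X :=
  (unit.degenerateChains n X).mkQ

theorem normalize_eq_zero {c : unit.cubicalFree n X} (h : c ∈ unit.degenerateChains n X) :
    normalize n X c = 0 :=
  (Submodule.Quotient.mk_eq_zero _).mpr h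

theorem cubicalPush_normalize (f : Map Y X) (c : unit.cubicalFree n Y) :
    cubicalPush n f (normalize n Y c) = normalize n X (pushforward _ f c) := rfl

theorem cubicalD_normalize (c : unit.cubicalFree (n + 1) X) :
    cubicalD n X (normalize (n + 1) X c) = normalize n X (unit.cubicalBoundary n X c) := rfl

theorem cubicalD_push (f : Map Y X) (z : CubicalChains (n + 1) Y) :
    cubicalD n X (cubicalPush (n + 1) f z) = cubicalPush n f (cubicalD n Y z) := by
  obtain ⟨c, rfl⟩ := Submodule.mkQ_surjective _ z
  exact congrArg (normalize n X) (pushforward_cubicalBoundary f c).symm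

theorem pushforward_comp {K Z : Cl} (f : Map Y X) (g : Map Z Y) (c : Map K Z →₀ ℤ) :
    pushforward K (f.comp g) c = pushforward K f (pushforward K g c) := by
  induction c using Finsupp.induction_linear with
  | zero => simp
  | add c d hc hd => simp only [map_add, hc, hd]
  | single σ r => simp only [pushforward_single]; rfl

theorem cubicalPush_comp {Z : Cl} (f : Map Y X) (g : Map Z Y) (z : CubicalChains n Z) :
    cubicalPush n (f.comp g) z = cubicalPush n f (cubicalPush n g z) := by
  obtain ⟨c, rfl⟩ := Submodule.mkQ_surjective _ z
  exact congrArg (normalize n X) (pushforward_comp f g c)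

/-- The natural operation on cubical chains determined by its value on the universal cube. -/
def cubicalOp (t : CubicalChains m (unit.cube n)) (X : Cl.{u}) :
    unit.cubicalFree n X →ₗ[ℤ] CubicalChains m X :=
  Finsupp.linearCombination ℤ (fun σ : unit.Cube n X => cubicalPush m σ t)

theorem cubicalOp_single (t : CubicalChains m (unit.cube n)) (σ : unit.Cube n X) :
    cubicalOp t X (Finsupp.single σ 1) = cubicalPush m σ t := by
  rw [cubicalOp, Finsupp.linearCombination_single, one_smul]

theorem cubicalPush_cubicalOp (t : CubicalChains m (unit.cube n)) (f : Map Y X)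
    (c : unit.cubicalFree n Y) :
    cubicalPush m f (cubicalOp t Y c) = cubicalOp t X (pushforward _ f c) := by
  refine LinearMap.congr_fun (f := cubicalPush m f ∘ₗ cubicalOp t Y)
    (g := cubicalOp t X ∘ₗ pushforward _ f) (cubicalFree_hom_ext fun σ => ?_) c
  simp only [LinearMap.comp_apply, pushforward_single, cubicalOp_single, cubicalPush_comp]

/-! #### The cone -/

/-- Scaling of the cube towards the origin. -/
def scale (t : unitInterval) (y : Fin n → unitInterval) : Fin n → unitInterval := fun i => t * y i

/-- The cone over a singular cube of a cube, with apex the origin. -/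
def cubeCone (σ : Map (unit.cube m) (unit.cube n)) : Map (unit.cube (m + 1)) (unit.cube n) :=
  cubeMap (fun x => scale (x 0) (σ.toFun (Fin.tail x))) (by
    have h := (continuous_of_cubeMap σ).comp (f := fun x : Fin (m + 1) → unitInterval =>
      (Fin.tail x : Fin m → unitInterval)) (continuous_pi fun j => continuous_apply _)
    exact continuous_pi fun i => (continuous_apply 0).mul ((continuous_apply i).comp h))

/-- The cone operator on chains of a cube. -/
def coneFree (m n : ℕ) :
    unit.cubicalFree m (unit.cube n) →ₗ[ℤ] unit.cubicalFree (m + 1) (unit.cube n) :=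
  Finsupp.lmapDomain ℤ ℤ (cubeCone (m := m) (n := n))

theorem coneFree_single (σ : unit.Cube m (unit.cube n)) (r : ℤ) :
    coneFree m n (Finsupp.single σ r) = Finsupp.single (cubeCone σ) r :=
  Finsupp.mapDomain_single

/-- The cone parameter is coordinate `0`, so the coordinates of the base shift up by one. -/
theorem cubeCone_codegeneracy (i : Fin (m + 1)) (τ : unit.Cube m (unit.cube n)) :
    cubeCone (τ.comp (unit.codegeneracy i)) = (cubeCone τ).comp (unit.codegeneracy i.succ) := by
  apply Map.ext
  funext x
  change scale (x 0) (τ.toFun fun l => x (i.succAbove l).succ) =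
    scale (x (i.succ.succAbove 0)) (τ.toFun fun l => x (i.succ.succAbove l.succ))
  have h : (fun l => x (i.succ.succAbove l.succ)) = fun l => x (i.succAbove l).succ :=
    funext fun l => congrArg x (Fin.succ_succAbove_succ i l)
  rw [h]
  rfl

theorem coneFree_degenerate : unit.degenerateChains m (unit.cube n) ≤
    (unit.degenerateChains (m + 1) (unit.cube n)).comap (coneFree m n) := by
  cases m with
  | zero => rw [degenerateChains_zero]; exact bot_le
  | succ m =>
    refine degenerateChains_le fun i τ => ?_
    change coneFree _ _ _ ∈ unit.degenerateChains _ _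
    rw [coneFree_single, cubeCone_codegeneracy]
    exact single_codegeneracy_mem _ _ _

/-- The cone operator on normalized chains of a cube. -/
def coneOp (m n : ℕ) : CubicalChains m (unit.cube n) →ₗ[ℤ] CubicalChains (m + 1) (unit.cube n) :=
  Submodule.mapQ _ _ (coneFree m n) coneFree_degenerate

theorem coneOp_normalize (c : unit.cubicalFree m (unit.cube n)) :
    coneOp m n (normalize m _ c) = normalize (m + 1) _ (coneFree m n c) := rfl

theorem cubeCone_coface_succ (σ : unit.Cube (m + 1) (unit.cube n)) (i : Fin (m + 1)) (ε : Bool) :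
    (cubeCone σ).comp (unit.coface i.succ ε) = cubeCone (σ.comp (unit.coface i ε)) := by
  apply Map.ext
  funext x
  have h0 : (i.succ.insertNth (α := fun _ => unit.space) (unit.endpoint ε) x) 0 = x 0 := by
    have := Fin.insertNth_apply_succAbove (α := fun _ => unit.space) i.succ (unit.endpoint ε) x 0
    rwa [Fin.succ_succAbove_zero] at this
  have h1 : Fin.tail (i.succ.insertNth (α := fun _ => unit.space) (unit.endpoint ε) x) =
      i.insertNth (α := fun _ => unit.space) (unit.endpoint ε) (Fin.tail x) := by
    funext j
    rcases Fin.eq_self_or_eq_succAbove i j with rfl | ⟨l, rfl⟩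
    · rw [Fin.insertNth_apply_same]
      exact Fin.insertNth_apply_same (α := fun _ => unit.space) _ _ _
    · rw [Fin.insertNth_apply_succAbove]
      have := Fin.insertNth_apply_succAbove (α := fun _ => unit.space) i.succ (unit.endpoint ε) x
        l.succ
      rwa [Fin.succ_succAbove_succ] at this
  change scale ((i.succ.insertNth (α := fun _ => unit.space) (unit.endpoint ε) x) 0)
    (σ.toFun (Fin.tail (i.succ.insertNth (α := fun _ => unit.space) (unit.endpoint ε) x))) =
    scale (x 0) (σ.toFun (i.insertNth (α := fun _ => unit.space) (unit.endpoint ε) (Fin.tail x)))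
  rw [h0, h1]

theorem tail_coface_zero (ε : Bool) (x : unit.cube m) :
    Fin.tail ((unit.coface 0 ε).toFun x) = x := by
  funext j
  exact Fin.insertNth_apply_succAbove (α := fun _ => unit.space) 0 (unit.endpoint ε) x j

theorem cubeCone_coface_zero_true (σ : unit.Cube m (unit.cube n)) :
    (cubeCone σ).comp (unit.coface 0 true) = σ := by
  apply Map.ext
  funext x
  change scale 1 (σ.toFun (Fin.tail ((unit.coface 0 true).toFun x))) = σ.toFun x
  rw [tail_coface_zero]
  exact funext fun j => one_mul (M := unitInterval) _

/-- At parameter `0` the cone collapses to the origin. A constant cube is degenerate once its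
dimension is positive, so this face disappears after normalization. -/
theorem cubeCone_coface_zero_false (σ : unit.Cube (m + 1) (unit.cube n)) :
    (cubeCone σ).comp (unit.coface 0 false) =
      (cubeMap (m := m) (fun _ _ => 0) continuous_const).comp (unit.codegeneracy 0) := by
  apply Map.ext
  funext x
  exact funext fun j => zero_mul (M₀ := unitInterval) _

/-- In direction `0` the end face is `z`, with sign `+1`, and the initial face is degenerate. The
remaining faces are cones over faces with the opposite sign. -/
theorem cubicalD_coneOp (z : CubicalChains (m + 1) (unit.cube n)) :
    cubicalD (m + 1) _ (coneOp (m + 1) n z) = z - coneOp m n (cubicalD m _ z) := by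
  obtain ⟨c, rfl⟩ := Submodule.mkQ_surjective _ z
  rw [coneOp_normalize, cubicalD_normalize, cubicalD_normalize, coneOp_normalize]
  refine LinearMap.congr_fun
    (f := normalize (m + 1) _ ∘ₗ unit.cubicalBoundary (m + 1) _ ∘ₗ coneFree (m + 1) n)
    (g := normalize (m + 1) _ - normalize (m + 1) _ ∘ₗ coneFree m n ∘ₗ unit.cubicalBoundary m _)
    (cubicalFree_hom_ext fun σ => ?_) c
  simp only [LinearMap.comp_apply, LinearMap.sub_apply]
  rw [coneFree_single, cubicalBoundary_single, cubicalBoundary_single, Fin.sum_univ_succ, map_add,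
    sub_eq_add_neg (normalize _ _ _)]
  congr 1
  · rw [cubeCone_coface_zero_true, cubeCone_coface_zero_false, map_smul, map_sub,
      normalize_eq_zero (single_codegeneracy_mem _ _ _)]
    simp
  · rw [← map_neg]
    congr 1
    rw [map_sum, ← Finset.sum_neg_distrib]
    refine Finset.sum_congr rfl fun i _ => ?_
    rw [map_smul, map_sub, coneFree_single, coneFree_single, cubeCone_coface_succ,
      cubeCone_coface_succ, Fin.val_succ, pow_succ _ ((i : ℕ) + 1), mul_neg_one, neg_smul]

/-- Forgetting a coordinate commutes with scaling towards the origin. -/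
theorem cubicalPush_codegeneracy_coneOp (i : Fin (n + 1))
    (z : CubicalChains m (unit.cube (n + 1))) :
    cubicalPush (m + 1) (unit.codegeneracy i) (coneOp m (n + 1) z) =
      coneOp m n (cubicalPush m (unit.codegeneracy i) z) := by
  obtain ⟨c, rfl⟩ := Submodule.mkQ_surjective _ z
  rw [coneOp_normalize, cubicalPush_normalize, cubicalPush_normalize, coneOp_normalize]
  congr 1
  refine LinearMap.congr_fun (f := pushforward _ (unit.codegeneracy i) ∘ₗ coneFree m (n + 1))
    (g := coneFree m n ∘ₗ pushforward _ (unit.codegeneracy i))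
    (cubicalFree_hom_ext fun σ => ?_) c
  simp only [LinearMap.comp_apply, coneFree_single, pushforward_single]
  rfl

end CubicalSubdivision

section GridSubdivision

open Cl IntervalObj

variable {X : Cl.{u}} {Y : Cl.{v}} {m n : ℕ}

/-! #### Grid subdivision -/

/-- The affine map of the interval onto the `l`-th of `k + 1` equal parts. -/
def gridCut (k l : ℕ) (x : unitInterval) : unitInterval :=
  Set.projIcc 0 1 zero_le_one (((l : ℝ) + x) / (k + 1))

theorem continuous_gridCut (k l : ℕ) : Continuous (gridCut k l) :=
  continuous_projIcc.comp ((continuous_const.add continuous_subtype_val).div_const _)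

/-- Adjacent cells share an endpoint, so interior faces cancel. The right end of the last cell
appears as the left end of a fictitious cell `k + 1`. -/
theorem gridCut_one (k l : ℕ) : gridCut k l 1 = gridCut k (l + 1) 0 := by
  simp [gridCut]

theorem gridCut_zero_zero (k : ℕ) : gridCut k 0 0 = 0 := by
  simp [gridCut]

theorem gridCut_last_zero (k : ℕ) : gridCut k (k + 1) 0 = 1 := by
  have h : ((k : ℝ) + 1) / (k + 1) = 1 := div_self (by positivity)
  simp [gridCut, h]

theorem dist_gridCut_le (k l : ℕ) (x y : unitInterval) :
    dist (gridCut k l x) (gridCut k l y) ≤ 1 / (k + 1) := by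
  have hk : (0 : ℝ) < k + 1 := by positivity
  rw [Subtype.dist_eq, Real.dist_eq]
  refine (Set.abs_projIcc_sub_projIcc zero_le_one).trans ?_
  rw [← sub_div, add_sub_add_left_eq_sub, abs_div, abs_of_pos hk]
  gcongr
  rw [abs_le]
  constructor <;> linarith [x.2.1, x.2.2, y.2.1, y.2.2]

/-- The inclusion of a cell of the grid. -/
def gridMap (k : ℕ) (j : Fin n → Fin (k + 1)) : Map (unit.cube n) (unit.cube n) :=
  cubeMap (fun x i => gridCut k (j i) (x i))
    (continuous_pi fun i => (continuous_gridCut k (j i)).comp (continuous_apply i))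

/-- The inclusion of a slice with constant `i`-th coordinate. -/
def slice (i : Fin (n + 1)) (p : unitInterval) : Map (unit.cube n) (unit.cube (n + 1)) :=
  cubeMap (fun x => i.insertNth (α := fun _ => unitInterval) p x)
    (Continuous.finInsertNth i continuous_const continuous_id)

theorem gridMap_comp_coface (k : ℕ) (i : Fin (n + 1)) (l : Fin (k + 1))
    (j : Fin n → Fin (k + 1)) (ε : Bool) :
    (gridMap k (i.insertNth (α := fun _ => Fin (k + 1)) l j)).comp (unit.coface i ε) =
      (slice i (gridCut k l (unit.endpoint ε))).comp (gridMap k j) := by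
  apply Map.ext
  funext (x : Fin n → unitInterval)
  have h : ∀ p : unitInterval, (fun a => gridCut k (i.insertNth (α := fun _ => Fin (k + 1)) l j a)
      (i.insertNth (α := fun _ => unitInterval) p x a)) =
      i.insertNth (α := fun _ => unitInterval) (gridCut k l p)
        (fun a => gridCut k (j a) (x a)) := by
    intro p
    funext a
    rcases Fin.eq_self_or_eq_succAbove i a with rfl | ⟨b, rfl⟩
    · simp only [Fin.insertNth_apply_same]
    · simp only [Fin.insertNth_apply_succAbove]
  exact h (unit.endpoint ε)

/-- The subdivision of singular cubes into the cells of the grid. -/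
def gridSubdivision (k n : ℕ) (X : Cl.{u}) :
    unit.cubicalFree n X →ₗ[ℤ] unit.cubicalFree n X :=
  Finsupp.linearCombination ℤ (fun σ : unit.Cube n X =>
    ∑ j : Fin n → Fin (k + 1), Finsupp.single (σ.comp (gridMap k j)) 1)

theorem gridSubdivision_single (k : ℕ) (σ : unit.Cube n X) :
    gridSubdivision k n X (Finsupp.single σ 1) =
      ∑ j : Fin n → Fin (k + 1), Finsupp.single (σ.comp (gridMap k j)) 1 := by
  rw [gridSubdivision, Finsupp.linearCombination_single, one_smul]

theorem gridSubdivision_zero (k : ℕ) (c : unit.cubicalFree 0 X) :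
    gridSubdivision k 0 X c = c := by
  refine LinearMap.congr_fun (f := gridSubdivision k 0 X) (g := LinearMap.id)
    (cubicalFree_hom_ext fun σ => ?_) c
  rw [gridSubdivision_single, Fintype.sum_unique, LinearMap.id_apply]
  congr 1
  exact Map.ext (funext fun x => congrArg σ.toFun (funext fun i => i.elim0))

theorem pushforward_gridSubdivision (k : ℕ) (f : Map Y X) (c : unit.cubicalFree n Y) :
    pushforward _ f (gridSubdivision k n Y c) = gridSubdivision k n X (pushforward _ f c) := by
  refine LinearMap.congr_fun (f := pushforward _ f ∘ₗ gridSubdivision k n Y)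
    (g := gridSubdivision k n X ∘ₗ pushforward _ f) (cubicalFree_hom_ext fun σ => ?_) c
  simp only [LinearMap.comp_apply, pushforward_single, gridSubdivision_single, map_sum]
  rfl

theorem gridSubdivision_degenerate (k : ℕ) :
    unit.degenerateChains n X ≤ (unit.degenerateChains n X).comap (gridSubdivision k n X) := by
  cases n with
  | zero => rw [degenerateChains_zero]; exact bot_le
  | succ n =>
    refine degenerateChains_le fun i τ => ?_
    change gridSubdivision k (n + 1) X _ ∈ unit.degenerateChains (n + 1) X
    rw [gridSubdivision_single]
    refine Submodule.sum_mem _ fun j _ => ?_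
    exact single_codegeneracy_mem i (τ.comp (gridMap k fun a => j (i.succAbove a))) 1

/-- In each direction the faces of the cells telescope, leaving the slices at `0` and `1`, which are
the subdivided faces of the cube. -/
theorem cubicalBoundary_gridSubdivision (k : ℕ) (c : unit.cubicalFree (n + 1) X) :
    unit.cubicalBoundary n X (gridSubdivision k (n + 1) X c) =
      gridSubdivision k n X (unit.cubicalBoundary n X c) := by
  refine LinearMap.congr_fun (f := unit.cubicalBoundary n X ∘ₗ gridSubdivision k (n + 1) X)
    (g := gridSubdivision k n X ∘ₗ unit.cubicalBoundary n X)
    (cubicalFree_hom_ext fun σ => ?_) c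
  simp only [LinearMap.comp_apply, gridSubdivision_single, cubicalBoundary_single, map_sum,
    map_smul, map_sub]
  rw [Finset.sum_comm]
  refine Finset.sum_congr rfl fun i _ => ?_
  rw [← Finset.smul_sum]
  congr 1
  -- A cell is split into its position `l` in direction `i` and its position `j` in the others; the
  -- telescoping is over `l`.
  rw [← Equiv.sum_comp (Fin.insertNthEquiv (fun _ => Fin (k + 1)) i), Fintype.sum_prod_type,
    Finset.sum_comm, ← Finset.sum_sub_distrib]
  refine Finset.sum_congr rfl fun j _ => ?_
  have h : ∀ (l : Fin (k + 1)) (ε : Bool), (σ.comp (gridMap k (Fin.insertNthEquiv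
      (fun _ => Fin (k + 1)) i (l, j)))).comp (unit.coface i ε) =
      σ.comp ((slice i (gridCut k l (unit.endpoint ε))).comp (gridMap k j)) := fun l ε =>
    congrArg σ.comp (gridMap_comp_coface k i l j ε)
  have e : ∀ l : ℕ, gridCut k l (unit.endpoint true) = gridCut k (l + 1) (unit.endpoint false) :=
    gridCut_one k
  simp only [h, e]
  let F : ℕ → unit.cubicalFree n X := fun l => Finsupp.single
    (σ.comp ((slice i (gridCut k l (unit.endpoint false))).comp (gridMap k j))) 1
  refine (Finset.sum_range fun l => F l - F (l + 1)).symm.trans ?_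
  rw [Finset.sum_range_sub' F]
  simp only [F]
  have e0 : gridCut k 0 (unit.endpoint false) = 0 := gridCut_zero_zero k
  have e1 : gridCut k (k + 1) (unit.endpoint false) = 1 := gridCut_last_zero k
  rw [e0, e1]
  rfl

/-! #### The homotopy -/

/-- The value on the universal cube of the homotopy between grid subdivision and the identity. -/
def gridHomotopyChain (k : ℕ) : ∀ n, CubicalChains (n + 1) (unit.cube n)
  | 0 => 0
  | n + 1 => coneOp (n + 1) (n + 1)
      (normalize (n + 1) (unit.cube (n + 1)) (Finsupp.single (Map.id _) 1 -
        gridSubdivision k (n + 1) _ (Finsupp.single (Map.id _) 1)) -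
      cubicalOp (gridHomotopyChain k n) (unit.cube (n + 1))
        (unit.cubicalBoundary n _ (Finsupp.single (Map.id _) 1)))

/-- The homotopy between grid subdivision and the identity. -/
def gridHomotopy (k n : ℕ) (X : Cl.{u}) : unit.cubicalFree n X →ₗ[ℤ] CubicalChains (n + 1) X :=
  cubicalOp (gridHomotopyChain k n) X

/-- The defect which the homotopy in the next degree has to bound. -/
def gridDefect (k n : ℕ) (X : Cl.{u}) :
    unit.cubicalFree (n + 1) X →ₗ[ℤ] CubicalChains (n + 1) X :=
  normalize (n + 1) X ∘ₗ (LinearMap.id - gridSubdivision k (n + 1) X) -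
    gridHomotopy k n X ∘ₗ unit.cubicalBoundary n X

theorem gridHomotopyChain_succ (k n : ℕ) : gridHomotopyChain k (n + 1) =
    coneOp (n + 1) (n + 1) (gridDefect k n _ (Finsupp.single (Map.id _) 1)) := rfl

theorem cubicalPush_gridDefect (k : ℕ) (f : Map Y X) (c : unit.cubicalFree (n + 1) Y) :
    cubicalPush (n + 1) f (gridDefect k n Y c) = gridDefect k n X (pushforward _ f c) := by
  simp only [gridDefect, LinearMap.sub_apply, LinearMap.comp_apply, LinearMap.id_apply, map_sub,
    cubicalPush_normalize, gridHomotopy, cubicalPush_cubicalOp, pushforward_gridSubdivision,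
    pushforward_cubicalBoundary]

theorem gridHomotopy_degenerate_zero (k : ℕ) {c : unit.cubicalFree 0 X}
    (hc : c ∈ unit.degenerateChains 0 X) : gridHomotopy k 0 X c = 0 := by
  rw [degenerateChains_zero] at hc
  rw [(Submodule.mem_bot ℤ).mp hc, map_zero]

/-- On `τ` composed with a projection the homotopy is the image under `τ` of the projected universal
chain, so it suffices that projections kill that chain. -/
theorem gridHomotopy_degenerate_of_push (k n : ℕ)
    (h : ∀ i, cubicalPush (n + 2) (unit.codegeneracy i) (gridHomotopyChain k (n + 1)) = 0)
    {c : unit.cubicalFree (n + 1) X} (hc : c ∈ unit.degenerateChains (n + 1) X) :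
    gridHomotopy k (n + 1) X c = 0 := by
  refine (LinearMap.mem_ker (f := gridHomotopy k (n + 1) X)).mp
    (degenerateChains_le (fun i τ => ?_) hc)
  rw [LinearMap.mem_ker, gridHomotopy, cubicalOp_single, cubicalPush_comp, h, map_zero]

/-- Projection commutes with the cone and turns the universal defect into the defect of a degenerate
cube. That one vanishes: subdivision and boundary preserve degeneracy, and the homotopy one degree
lower kills degenerate chains. With the previous lemma this gives an induction on the degree. -/
theorem push_gridHomotopyChain_of_degenerate (k n : ℕ)
    (h : ∀ c ∈ unit.degenerateChains n (unit.cube n), gridHomotopy k n (unit.cube n) c = 0)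
    (i : Fin (n + 1)) :
    cubicalPush (n + 2) (unit.codegeneracy i) (gridHomotopyChain k (n + 1)) = 0 := by
  rw [gridHomotopyChain_succ, cubicalPush_codegeneracy_coneOp, cubicalPush_gridDefect,
    pushforward_single]
  have hd : Finsupp.single ((unit.codegeneracy i).comp (Map.id _)) 1 ∈
      unit.degenerateChains (n + 1) (unit.cube n) := single_codegeneracy_mem i (Map.id _) 1
  have h0 : gridDefect k n (unit.cube n)
      (Finsupp.single ((unit.codegeneracy i).comp (Map.id _)) 1) = 0 := by
    rw [gridDefect, LinearMap.sub_apply, LinearMap.comp_apply, LinearMap.comp_apply,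
      h _ (unit.cubicalBoundary_degenerate n _ hd), LinearMap.sub_apply, LinearMap.id_apply,
      normalize_eq_zero (Submodule.sub_mem _ hd (gridSubdivision_degenerate k hd)), sub_zero]
  rw [h0, map_zero]

theorem push_gridHomotopyChain (k n : ℕ) (i : Fin (n + 1)) :
    cubicalPush (n + 2) (unit.codegeneracy i) (gridHomotopyChain k (n + 1)) = 0 := by
  induction n with
  | zero =>
    exact push_gridHomotopyChain_of_degenerate k 0
      (fun _ => gridHomotopy_degenerate_zero k) i
  | succ n ih =>
    exact push_gridHomotopyChain_of_degenerate k (n + 1)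
      (fun _ => gridHomotopy_degenerate_of_push k n ih) i

theorem gridHomotopy_degenerate (k n : ℕ) (X : Cl.{u}) {c : unit.cubicalFree n X}
    (hc : c ∈ unit.degenerateChains n X) : gridHomotopy k n X c = 0 := by
  cases n with
  | zero => exact gridHomotopy_degenerate_zero k hc
  | succ n => exact gridHomotopy_degenerate_of_push k n (push_gridHomotopyChain k n) hc

/-- By naturality it suffices to look at the universal cube, where the boundary of the cone over a
cycle is that cycle. -/
theorem cubicalD_gridHomotopy_of_defect (k n : ℕ)
    (h : cubicalD n _ (gridDefect k n (unit.cube (n + 1)) (Finsupp.single (Map.id _) 1)) = 0)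
    (c : unit.cubicalFree (n + 1) X) :
    cubicalD (n + 1) X (gridHomotopy k (n + 1) X c) = gridDefect k n X c := by
  refine LinearMap.congr_fun (f := cubicalD (n + 1) X ∘ₗ gridHomotopy k (n + 1) X)
    (g := gridDefect k n X) (cubicalFree_hom_ext fun σ => ?_) c
  rw [LinearMap.comp_apply, gridHomotopy, cubicalOp_single, cubicalD_push, gridHomotopyChain_succ,
    cubicalD_coneOp, h, map_zero, sub_zero, cubicalPush_gridDefect, pushforward_single]
  rfl

/-- With `∂T = id - sd - T∂` one degree lower, `∂(id - sd - T∂) = ∂ - sd ∂ - (id - sd - T∂)∂ = 0`.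
At the bottom, `T = 0` and `sd = id` on points. -/
theorem cubicalD_gridDefect (k n : ℕ) :
    cubicalD n _ (gridDefect k n (unit.cube (n + 1)) (Finsupp.single (Map.id _) 1)) = 0 := by
  induction n with
  | zero =>
    have h0 : gridHomotopy k 0 (unit.cube 1) = 0 :=
      cubicalFree_hom_ext fun σ => (cubicalOp_single _ σ).trans (map_zero _)
    rw [gridDefect, h0, LinearMap.zero_comp, sub_zero, LinearMap.comp_apply, cubicalD_normalize,
      LinearMap.sub_apply, map_sub, cubicalBoundary_gridSubdivision, gridSubdivision_zero,
      LinearMap.id_apply, sub_self, map_zero]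
  | succ n ih =>
    set ι : unit.cubicalFree (n + 2) (unit.cube (n + 2)) := Finsupp.single (Map.id _) 1
    have hdd : unit.cubicalBoundary n _ (unit.cubicalBoundary (n + 1) _ ι) = 0 :=
      LinearMap.congr_fun (unit.cubicalBoundary_comp n _) ι
    rw [gridDefect, LinearMap.sub_apply, LinearMap.comp_apply, LinearMap.comp_apply, map_sub,
      cubicalD_normalize, cubicalD_gridHomotopy_of_defect k n ih, gridDefect]
    simp only [LinearMap.sub_apply, LinearMap.comp_apply, LinearMap.id_apply, hdd, map_zero,
      sub_zero, map_sub, cubicalBoundary_gridSubdivision, sub_self]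

theorem cubicalD_gridHomotopy (k n : ℕ) (X : Cl.{u}) (c : unit.cubicalFree (n + 1) X) :
    cubicalD (n + 1) X (gridHomotopy k (n + 1) X c) = gridDefect k n X c :=
  cubicalD_gridHomotopy_of_defect k n (cubicalD_gridDefect k n) c

/-! #### Smallness -/

/-- The operation only composes `σ` with cubes of its domain, so values stay in `A` or in `B`. -/
theorem cubicalOp_mem {A B : Set X} (t : CubicalChains m (unit.cube n))
    {c : unit.cubicalFree n X} (hc : c ∈ smallChains (unit.cube n) A B) :
    cubicalOp t X c ∈ (smallChains (unit.cube m) A B).map (normalize m X) := by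
  refine map_mem_of_mem_smallChains _ _ (fun σ hσ => ?_) hc
  rw [cubicalOp_single]
  obtain ⟨t, rfl⟩ := Submodule.mkQ_surjective _ t
  refine ⟨pushforward _ σ t, ?_, rfl⟩
  change pushforward _ σ t ∈ smallChains (unit.cube m) A B
  induction t using Finsupp.induction_linear with
  | zero => simp
  | add c d hc hd => simpa only [map_add] using Submodule.add_mem _ hc hd
  | single τ r =>
    rw [pushforward_single]
    exact single_mem_smallChains (hσ.imp (fun h x => h _) (fun h x => h _)) r

/-- The cells have side at most `1/(k+1)` in the sup metric, so a single fine grid suffices and no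
iteration is needed. -/
theorem exists_gridSubdivision_single_mem {A B : Set X} (hAB : X.IsInteriorCover {A, B})
    (σ : unit.Cube n X) : ∃ N, ∀ k ≥ N, gridSubdivision k n X (Finsupp.single σ 1) ∈
      smallChains (unit.cube n) A B := by
  obtain ⟨δ, hδ, hL⟩ := Map.exists_lebesgue_number (Y := Fin n → unitInterval) hAB
    (σ.comp (toCube n))
  obtain ⟨N, hN⟩ := exists_nat_one_div_lt hδ
  refine ⟨N, fun k hk => ?_⟩
  rw [gridSubdivision_single]
  refine Submodule.sum_mem _ fun j _ => ?_
  let p : Fin n → unitInterval := fun i => gridCut k (j i) 0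
  have hball : ∀ x : Fin n → unitInterval,
      (fun i => gridCut k (j i) (x i)) ∈ Metric.ball p δ := by
    intro x
    rw [Metric.mem_ball, dist_pi_lt_iff hδ]
    refine fun i => (dist_gridCut_le k _ _ _).trans_lt (lt_of_le_of_lt ?_ hN)
    exact one_div_le_one_div_of_le (by positivity)
      (by have : (N : ℝ) ≤ k := Nat.cast_le.mpr hk
          linarith)
  exact single_mem_smallChains
    ((hL p).imp (fun h x => h _ (hball x)) (fun h x => h _ (hball x))) 1

theorem exists_gridSubdivision_mem {A B : Set X} (hAB : X.IsInteriorCover {A, B})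
    (c : unit.cubicalFree n X) : ∃ N, ∀ k ≥ N, gridSubdivision k n X c ∈
      smallChains (unit.cube n) A B := by
  induction c using Finsupp.induction_linear with
  | zero => exact ⟨0, fun k _ => by rw [map_zero]; exact Submodule.zero_mem _⟩
  | add c d hc hd =>
    obtain ⟨N, hN⟩ := hc
    obtain ⟨M, hM⟩ := hd
    refine ⟨max N M, fun k hk => ?_⟩
    rw [map_add]
    exact Submodule.add_mem _ (hN k (le_of_max_le_left hk)) (hM k (le_of_max_le_right hk))
  | single σ r =>
    obtain ⟨N, hN⟩ := exists_gridSubdivision_single_mem hAB σ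
    refine ⟨N, fun k hk => ?_⟩
    rw [← Finsupp.smul_single_one, map_smul]
    exact Submodule.smul_mem _ _ (hN k hk)

theorem inclusionInducesIso_cubicalChains_unit (X : Cl.{u}) {A B : Set X}
    (hAB : X.IsInteriorCover {A, B}) (n : ℕ) :
    InclusionInducesIso unit.cubicalChains X B (A ∩ B) A Set.inter_subset_left n := by
  refine unit.inclusionInducesIso_cubicalChains X ?_ ?_ n
  · intro c
    obtain ⟨N, hN⟩ := exists_gridSubdivision_mem hAB c
    have := hN N le_rfl
    rw [gridSubdivision_zero] at this
    exact Submodule.mem_sup_left this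
  · intro n c hc
    obtain ⟨k, hk⟩ := exists_gridSubdivision_mem hAB c
    have hk := hk k le_rfl
    -- The homotopy kills the degenerate part `d` of the boundary and sends the small part `s` to
    -- the class of a small chain `s'`.
    obtain ⟨s, hs, d, hd, hsd⟩ := Submodule.mem_sup.mp hc
    obtain ⟨s', hs', e'⟩ := cubicalOp_mem (gridHomotopyChain k n) hs
    obtain ⟨v, hv⟩ := Submodule.mkQ_surjective _ (gridHomotopy k (n + 1) X c)
    have h := cubicalD_gridHomotopy k n X c
    have hT : gridHomotopy k n X (unit.cubicalBoundary n X c) = normalize (n + 1) X s' := by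
      rw [← hsd, map_add, gridHomotopy_degenerate k n X hd, add_zero]
      exact e'.symm
    rw [← hv, gridDefect, LinearMap.sub_apply, LinearMap.comp_apply, LinearMap.comp_apply, hT,
      LinearMap.sub_apply, LinearMap.id_apply, cubicalD_normalize, ← map_sub] at h
    have hmem := (Submodule.Quotient.eq _).mp h
    refine ⟨v, ?_⟩
    -- `c - ∂v` equals `sd c + s'`, which is small, minus the degenerate chain `∂v - (c - sd c -
    -- s')`.
    have := Submodule.sub_mem _ (Submodule.mem_sup_left (Submodule.add_mem _ hk hs'))
      (Submodule.mem_sup_right (S := smallChains (unit.cube (n + 1)) A B) hmem)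
    convert this using 1
    abel

end GridSubdivision

/-! ### Excision -/

theorem inclusionInducesIso_of_isInteriorCover (J : IntervalObj) (X : Cl.{u}) {A B : Set X}
    (hAB : X.IsInteriorCover {A, B}) (n : ℕ) :
    InclusionInducesIso J.simplicialChains X B (A ∩ B) A Set.inter_subset_left n ∧
      InclusionInducesIso J.cubicalChains X B (A ∩ B) A Set.inter_subset_left n := by
  cases J with
  | unit => exact ⟨inclusionInducesIso_simplicialChains_unit X hAB n,
      inclusionInducesIso_cubicalChains_unit X hAB n⟩
  | plus => exact ⟨IntervalObj.plus.inclusionInducesIso_of_simplex_mem_cl _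
      IntervalObj.simplex_plus_mem_cl X hAB n,
      IntervalObj.plus.inclusionInducesIso_of_space_mem_cl (1 : Fin 2)
        (fun y => ⟨y, rfl, Fin.le_last (n := 1) y⟩) X hAB n⟩
  | one => exact ⟨IntervalObj.one.inclusionInducesIso_of_simplex_mem_cl _
      IntervalObj.simplex_one_mem_cl X hAB n,
      IntervalObj.one.inclusionInducesIso_of_space_mem_cl (1 : Fin 2)
        (fun y => ⟨y, rfl⟩) X hAB n⟩

end Pretop

end

theorem theorem1p5 (J : IntervalObj) (X : Cl.{u}) :
    (∀ Z A : Set X, Z ⊆ A → X.cl Z ⊆ X.int A → ∀ n : ℕ,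
      InclusionInducesIso J.simplicialChains X Zᶜ (A \ Z) A Set.sdiff_subset n ∧
      InclusionInducesIso J.cubicalChains X Zᶜ (A \ Z) A Set.sdiff_subset n) ∧
    (∀ A B : Set X, X.IsInteriorCover {A, B} → ∀ n : ℕ,
      InclusionInducesIso J.simplicialChains X B (A ∩ B) A Set.inter_subset_left n ∧
      InclusionInducesIso J.cubicalChains X B (A ∩ B) A Set.inter_subset_left n) := by
  refine ⟨fun Z A _ hZ n => ?_, fun A B hAB n => inclusionInducesIso_of_isInteriorCover J X hAB n⟩
  -- `A \ Z` is `A ∩ Zᶜ`, and the interior of `Zᶜ` is the complement of the closure of `Z`, so the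
  -- hypothesis on `Z` says exactly that `A` and `Zᶜ` form an interior cover.
  refine inclusionInducesIso_of_isInteriorCover J X (A := A) (B := Zᶜ) ?_ n
  rw [Cl.isInteriorCover_pair_iff]
  intro x
  by_cases hx : x ∈ X.cl Z
  · exact Or.inl (hZ hx)
  · right
    rwa [Cl.int, compl_compl]
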